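/- A signed graph $\Gamma=(G,\sigma)$ is a finite simple graph $G$ with a sign function $\sigma:E(G)\to\{+1,-1\}$. It is balanced if every cycle has an even number of negative edges, and unbalanced otherwise. Its adjacency matrix $A(\Gamma)$ has entry $\sigma(uv)$ at $(u,v)$ if $uv\in E(G)$ and $0$ otherwise; if $\lambda_1\ge\dots\ge\lambda_n$ are the eigenvalues of $A(\Gamma)$, then $\rho(\Gamma)=\max\{\lambda_1,-\lambda_n\}$. Write $\Gamma\sim\Gamma'$ if a graph isomorphic to $\Gamma'$ (as a signed graph) can be obtained from $\Gamma$ by finitely many switchings, a switching being the reversal of the signs of all edges between a nonempty proper vertex subset $U$ and its complement. For $t\ge 1$ let $t\mathcal K_4^-$ be the family of all signed graphs that are the union of $t$ distinct unbalanced signed complete graphs on four vertices, which are allowed to share vertices and edges; $\Gamma$ is $t\mathcal K_4^-$-free if it has no (sign-preserving) subgraph isomorphic to a member of $t\mathcal K_4^-$. Let $\Gamma_{s,n}$ be the signed graph obtained from the complete graph on $v_1,\dots,v_{n-1}$ by adding a vertex $v_n$ joined to $v_1,\dots,v_{s+1}$, where $v_1v_n$ is the only negative edge. There is an absolute constant $N$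 such that the following holds for all integers $n\ge N$. Let $t\ge 2$ be an integer such that $r=\frac{1+\sqrt{8t-7}}{2}$ is an integer and $r\le\lfloor n/2\rfloor-2$. Then every $t\mathcal K_4^-$-free unbalanced signed graph $\Gamma$ of order $n$ satisfies \[\rho(\Gamma)\le\rho(\Gamma_{r,n}),\] with equality if and only if $\Gamma\sim\Gamma_{r,n}$. -/

import Mathlib

/-- A signed graph on the vertex set `V`: an underlying simple graph with a sign `+1` or `-1` on
each edge. The function `sign` is total on unordered pairs, but every notion below reads it only
on the edges of `graph`. -/
structure SignedGraph (V : Type*) where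
  graph : SimpleGraph V
  sign : Sym2 V → ℤˣ

namespace SignedGraph

universe u v

variable {V : Type u} {W : Type v}

/-- Every cycle has an even number of negative edges. -/
def Balanced (Γ : SignedGraph V) : Prop :=
  ∀ (v : V) (c : Γ.graph.Walk v v), c.IsCycle → Even (c.edges.countP (fun e => Γ.sign e = -1))

def Unbalanced (Γ : SignedGraph V) : Prop := ¬ Γ.Balanced

/-- The signed subgraph induced by a set of vertices. -/
def induce (Γ : SignedGraph V) (S : Set V) : SignedGraph S where
  graph := Γ.graph.induce S
  sign := fun e => Γ.sign (e.map Subtype.val)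

/-- `Γ` has a subgraph, with the signs inherited from `Γ`, that is isomorphic to `F`. -/
def Contains (Γ : SignedGraph V) (F : SignedGraph W) : Prop :=
  ∃ f : W ↪ V, ∀ a b, F.graph.Adj a b →
    Γ.graph.Adj (f a) (f b) ∧ Γ.sign s(f a, f b) = F.sign s(a, b)

/-- `Γ` contains no subgraph isomorphic to a member of the family `𝓕`. -/
def FreeOf (Γ : SignedGraph V) (𝓕 : ∀ W : Type, SignedGraph W → Prop) : Prop :=
  ∀ (W : Type) (F : SignedGraph W), 𝓕 W F → ¬ Γ.Contains F

/-- The four vertices in `S` span an unbalanced signed complete graph `K₄⁻`. -/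
def IsUnbalancedK4 (Γ : SignedGraph V) (S : Finset V) : Prop :=
  Γ.graph.IsNClique 4 S ∧ (Γ.induce (S : Set V)).Unbalanced

/-- The family `t𝒦₄⁻`: signed graphs that are the union of `t` distinct unbalanced signed
complete graphs `K₄⁻`, which may share vertices (and edges). -/
def tK4Minus (t : ℕ) (W : Type) (F : SignedGraph W) : Prop :=
  ∃ 𝒮 : Finset (Finset W), 𝒮.card = t ∧ (∀ S ∈ 𝒮, F.IsUnbalancedK4 S) ∧
    (∀ a, ∃ S ∈ 𝒮, a ∈ S) ∧ (∀ a b, F.graph.Adj a b → ∃ S ∈ 𝒮, a ∈ S ∧ b ∈ S)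

open Classical in
/-- Reverse the signs of all edges between `U` and its complement. -/
noncomputable def switch (Γ : SignedGraph V) (U : Set V) : SignedGraph V where
  graph := Γ.graph
  sign := fun e => if (∃ a ∈ e, a ∈ U) ∧ (∃ b ∈ e, b ∉ U) then -Γ.sign e else Γ.sign e

/-- `Γ'` arises from `Γ` by one switching at a nonempty proper set of vertices. -/
def SwitchStep (Γ Γ' : SignedGraph V) : Prop :=
  ∃ U : Set V, U.Nonempty ∧ U ≠ Set.univ ∧ Γ' = Γ.switch U

/-- A sign-preserving isomorphism of signed graphs exists. -/
def Isomorphic (Γ : SignedGraph V) (Δ : SignedGraph W) : Prop :=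
  ∃ f : Γ.graph ≃g Δ.graph, ∀ a b, Γ.graph.Adj a b → Δ.sign s(f a, f b) = Γ.sign s(a, b)

/-- `Γ ∼ Δ`: a finite sequence of switchings turns `Γ` into a signed graph isomorphic to `Δ`. -/
def SwitchingEquivalent (Γ : SignedGraph V) (Δ : SignedGraph W) : Prop :=
  ∃ Γ' : SignedGraph V, Relation.ReflTransGen SwitchStep Γ Γ' ∧ Γ'.Isomorphic Δ

open Classical in
/-- The signed adjacency matrix. -/
noncomputable def adjMatrix (Γ : SignedGraph V) : Matrix V V ℝ :=
  Matrix.of fun a b => if Γ.graph.Adj a b then ((Γ.sign s(a, b) : ℤ) : ℝ) else 0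

theorem isHermitian_adjMatrix (Γ : SignedGraph V) : Γ.adjMatrix.IsHermitian := by
  ext a b
  simp only [adjMatrix, Matrix.conjTranspose_apply, Matrix.of_apply, star_trivial]
  rw [Sym2.eq_swap]
  by_cases h : Γ.graph.Adj a b
  · rw [if_pos h, if_pos h.symm]
  · rw [if_neg h, if_neg fun h' => h h'.symm]

section Spectrum

variable [Fintype V] [DecidableEq V]

/-- The largest eigenvalue `λ₁` of the adjacency matrix. -/
noncomputable def index (Γ : SignedGraph V) : ℝ := ⨆ i, Γ.isHermitian_adjMatrix.eigenvalues i

/-- The least eigenvalue `λₙ` of the adjacency matrix. -/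
noncomputable def leastEigenvalue (Γ : SignedGraph V) : ℝ :=
  ⨅ i, Γ.isHermitian_adjMatrix.eigenvalues i

/-- `ρ(Γ) = max {λ₁, -λₙ}`. -/
noncomputable def spectralRadius (Γ : SignedGraph V) : ℝ := max Γ.index (-Γ.leastEigenvalue)

end Spectrum

open Classical in
/-- The signed graph `Γ_{s,n}`, with the vertex `vᵢ` encoded as `i - 1 : Fin n`: the vertices
`v₁, …, vₙ₋₁` form a complete graph, `vₙ` is joined to `v₁, …, v_{s+1}`, and `v₁vₙ` is the unique
negative edge. -/
noncomputable def Gam (s n : ℕ) : SignedGraph (Fin n) where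
  graph :=
    { Adj := fun i j => i ≠ j ∧ (i.val + 1 = n → j.val < s + 1) ∧ (j.val + 1 = n → i.val < s + 1)
      symm := ⟨fun _ _ h => ⟨h.1.symm, h.2.2, h.2.1⟩⟩
      loopless := ⟨fun _ h => h.1 rfl⟩ }
  sign := fun e => if ∃ i j : Fin n, i.val = 0 ∧ j.val + 1 = n ∧ e = s(i, j) then -1 else 1

end SignedGraph

/-! The relation r(r-1) = 2(t-1) says that a clique on r vertices has t-1 edges. If uv forms
negative triangles with every vertex of a set W, each edge inside W yields another unbalanced K₄, so
W spans at most r(r-1)/2 edges. This is the only use of freeness.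

Suppose ρ(Γ) ≥ ρ(Γ_{r,n}), which exceeds n-2. Switch so that an eigenvector y for ±ρ(Γ) is
nonnegative, scaled to squared norm n. With A the switched adjacency matrix or its negative, the
defect D = J - I - A is entrywise nonnegative and yᵀDy = (Σy)² - (ρ+1)n < n. So A is nearly
complete, no coordinate of y is much above 1, and all but possibly the smallest are bounded below
(`card_sub_le_sum_sq`, `mul_ge_of_ne_min`).

For the eigenvalue -ρ, nearly all pairs are negative edges; some edge then forms negative triangles
with at least n-7 vertices, which span too many edges (`not_nearComplete_neg`).

For the eigenvalue ρ, unbalancedness leaves a negative edge uv, say with y_v ≤ y_u. It contributes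
4y_u y_v to yᵀDy; each w that is not a positive neighbour of both ends contributes at least 2y_v
y_w; common positive neighbours beyond the r-th force missing pairs that contribute even more. Hence
a copy of Γ_{r,n} on the same uv has no larger defect (`exists_missing_set`), and its Rayleigh
quotient at y is at least ρ(Γ). Equality makes y an eigenvector of the copy, and positivity of y
identifies the two matrices (`isomorphic_gam_of_le`). -/

open Matrix

/-! ### Counting unbalanced K₄ on an edge -/

namespace SignedGraph

/-- Some three vertices of `S` have signs whose product is negative. -/
def HasNegTriangle {V : Type*} (Γ : SignedGraph V) (S : Finset V) : Prop :=
  ∃ a ∈ S, ∃ b ∈ S, ∃ c ∈ S, a ≠ b ∧ b ≠ c ∧ c ≠ a ∧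
    Γ.sign s(a, b) * Γ.sign s(b, c) * Γ.sign s(c, a) = -1

/-- Such a triangle is a cycle with one or three negative edges. Negative triangles pass to subtypes
more easily than unbalancedness does. -/
theorem isUnbalancedK4_of_hasNegTriangle {V : Type*} {Γ : SignedGraph V} {S : Finset V}
    (hS : Γ.graph.IsNClique 4 S) (hT : Γ.HasNegTriangle S) : Γ.IsUnbalancedK4 S := by
  refine ⟨hS, fun hbal => ?_⟩
  obtain ⟨a, ha, b, hb, c, hc, hab, hbc, hca, hsg⟩ := hT
  let G := (Γ.induce (S : Set V)).graph
  let a' : (S : Set V) := ⟨a, ha⟩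
  let b' : (S : Set V) := ⟨b, hb⟩
  let c' : (S : Set V) := ⟨c, hc⟩
  have h1 : G.Adj a' b' := hS.1 ha hb hab
  have h2 : G.Adj b' c' := hS.1 hb hc hbc
  have h3 : G.Adj c' a' := hS.1 hc ha hca
  have hcyc : (SimpleGraph.Walk.cons h1 (.cons h2 (.cons h3 .nil))).IsCycle := by
    rw [SimpleGraph.Walk.cons_isCycle_iff]
    have e1 : a' ≠ b' := fun h => hab (congrArg Subtype.val h)
    have e2 : b' ≠ c' := fun h => hbc (congrArg Subtype.val h)
    have e3 : c' ≠ a' := fun h => hca (congrArg Subtype.val h)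
    simp [e1, e2, e3, e1.symm, e3.symm]
  have hev := hbal a' _ hcyc
  have s1 : (Γ.induce (S : Set V)).sign s(a', b') = Γ.sign s(a, b) := rfl
  have s2 : (Γ.induce (S : Set V)).sign s(b', c') = Γ.sign s(b, c) := rfl
  have s3 : (Γ.induce (S : Set V)).sign s(c', a') = Γ.sign s(c, a) := rfl
  simp only [SimpleGraph.Walk.edges_cons, SimpleGraph.Walk.edges_nil, List.countP_cons,
    List.countP_nil, s1, s2, s3] at hev
  rcases Int.units_eq_one_or (Γ.sign s(a, b)) with h | h <;>
  rcases Int.units_eq_one_or (Γ.sign s(b, c)) with h' | h' <;>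
  rcases Int.units_eq_one_or (Γ.sign s(c, a)) with h'' | h'' <;>
  rw [h, h', h''] at hsg hev <;> revert hsg hev <;> decide

/-- Collections of four-cliques with a negative triangle are small in a free signed graph. -/
theorem card_lt_of_freeOf {V : Type} [DecidableEq V] {Γ : SignedGraph V} {t : ℕ}
    (hfree : Γ.FreeOf (tK4Minus t)) (𝒯 : Finset (Finset V))
    (h𝒯 : ∀ S ∈ 𝒯, Γ.graph.IsNClique 4 S ∧ Γ.HasNegTriangle S) : 𝒯.card < t := by
  classical
  by_contra! hcard
  obtain ⟨𝒮, hsub, h𝒮⟩ := Finset.exists_subset_card_eq hcard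
  let p : V → Prop := fun a => ∃ S ∈ 𝒮, a ∈ S
  -- The union of the chosen cliques, on the vertices they cover. The family allows no uncovered
  -- vertex or edge, so an induced subgraph would not do.
  let F : SignedGraph {a // p a} :=
    { graph :=
        { Adj := fun a b => Γ.graph.Adj a b ∧ ∃ S ∈ 𝒮, a.1 ∈ S ∧ b.1 ∈ S
          symm := ⟨fun a b h => ⟨h.1.symm, by
            obtain ⟨S, h1, h2, h3⟩ := h.2; exact ⟨S, h1, h3, h2⟩⟩⟩
          loopless := ⟨fun a h => Γ.graph.loopless.irrefl _ h.1⟩ }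
      sign := fun e => Γ.sign (e.map Subtype.val) }
  have hmap : ∀ S ∈ 𝒮, (S.subtype p).map (Function.Embedding.subtype p) = S := fun S hS =>
    Finset.subtype_map_of_mem fun x hx => ⟨S, hS, hx⟩
  refine hfree _ F ⟨𝒮.image (fun S => S.subtype p), ?_, ?_, ?_, ?_⟩
    ⟨Function.Embedding.subtype p, fun a b h => ⟨h.1, rfl⟩⟩
  · rw [Finset.card_image_of_injOn, h𝒮]
    intro S hS T hT hST
    rw [← hmap S hS, ← hmap T hT]
    exact congrArg _ hST
  · intro S' hS'
    obtain ⟨S, hS, rfl⟩ := Finset.mem_image.1 hS'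
    obtain ⟨hcl, a, ha, b, hb, c, hc, h⟩ := h𝒯 S (hsub hS)
    apply isUnbalancedK4_of_hasNegTriangle
    · refine ⟨fun x hx y hy hxy => ?_, ?_⟩
      · have hx' : x.1 ∈ S := by simpa using hx
        have hy' : y.1 ∈ S := by simpa using hy
        exact ⟨hcl.1 hx' hy' fun h => hxy (Subtype.ext h), S, hS, hx', hy'⟩
      · rw [← hcl.2]
        conv_rhs => rw [← hmap S hS]
        rw [Finset.card_map]
    · refine ⟨⟨a, S, hS, ha⟩, by simpa using ha, ⟨b, S, hS, hb⟩, by simpa using hb,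
        ⟨c, S, hS, hc⟩, by simpa using hc, ?_, ?_, ?_, h.2.2.2⟩
      · exact fun e => h.1 (congrArg Subtype.val e)
      · exact fun e => h.2.1 (congrArg Subtype.val e)
      · exact fun e => h.2.2.1 (congrArg Subtype.val e)
  · rintro ⟨a, S, hS, ha⟩
    exact ⟨S.subtype p, Finset.mem_image_of_mem _ hS, by simpa using ha⟩
  · rintro ⟨a, ha'⟩ ⟨b, hb'⟩ ⟨-, S, hS, ha, hb⟩
    exact ⟨S.subtype p, Finset.mem_image_of_mem _ hS, by simpa using ha, by simpa using hb⟩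

open Classical in
/-- If `uv` forms a negative triangle with each vertex of `W`, the number of adjacent ordered pairs
in `W` is at most twice the number of allowed unbalanced `K₄`. -/
theorem card_adj_offDiag_le {V : Type} {Γ : SignedGraph V} {t : ℕ}
    (hfree : Γ.FreeOf (tK4Minus t)) {u v : V} (huv : Γ.graph.Adj u v) (W : Finset V)
    (hu : ∀ w ∈ W, Γ.graph.Adj u w) (hv : ∀ w ∈ W, Γ.graph.Adj v w)
    (hneg : ∀ w ∈ W, Γ.sign s(u, v) * Γ.sign s(v, w) * Γ.sign s(w, u) = -1) :
    (W.offDiag.filter fun p => Γ.graph.Adj p.1 p.2).card ≤ 2 * (t - 1) := by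
  set Q := W.offDiag.filter fun p => Γ.graph.Adj p.1 p.2 with hQ
  have hmemQ : ∀ p, p ∈ Q → p.1 ∈ W ∧ p.2 ∈ W ∧ p.1 ≠ p.2 ∧ Γ.graph.Adj p.1 p.2 := by
    intro p hp
    rw [hQ, Finset.mem_filter, Finset.mem_offDiag] at hp
    exact ⟨hp.1.1, hp.1.2.1, hp.1.2.2, hp.2⟩
  have huW : u ∉ W := fun h => (hu u h).ne rfl
  have hvW : v ∉ W := fun h => (hv v h).ne rfl
  -- As u and v lie outside W, a value of `f` on `Q` determines the pair up to order; hence the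
  -- factor 2.
  let f : V × V → Finset V := fun p => {u, v, p.1, p.2}
  have hlt : (Q.image f).card < t := by
    apply card_lt_of_freeOf hfree
    intro S hS
    obtain ⟨p, hp, rfl⟩ := Finset.mem_image.1 hS
    obtain ⟨h1, h2, hne, hadj⟩ := hmemQ p hp
    constructor
    · rw [show f p = insert u (insert v (insert p.1 {p.2})) from rfl]
      simp only [SimpleGraph.isNClique_iff, SimpleGraph.isClique_iff]
      have e1 := hu _ h1
      have e2 := hu _ h2
      have e3 := hv _ h1
      have e4 := hv _ h2
      constructor
      · intro x hx y hy hxy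
        simp only [Finset.coe_insert, Finset.coe_singleton, Set.mem_insert_iff,
          Set.mem_singleton_iff] at hx hy
        rcases hx with rfl | rfl | rfl | rfl <;> rcases hy with rfl | rfl | rfl | rfl <;>
          first
          | exact absurd rfl hxy
          | assumption
          | (apply SimpleGraph.Adj.symm; assumption)
      · rw [Finset.card_insert_of_notMem, Finset.card_insert_of_notMem,
          Finset.card_insert_of_notMem, Finset.card_singleton]
        · simpa using hne
        · simp [e3.ne, e4.ne]
        · simp [e1.ne, e2.ne, huv.ne]
    · exact ⟨u, by simp [f], v, by simp [f], p.1, by simp [f], huv.ne, (hv _ h1).ne,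
        (hu _ h1).ne.symm, hneg _ h1⟩
  have hle : Q.card ≤ 2 * (Q.image f).card := by
    apply Finset.card_le_mul_card_image
    intro S hS
    obtain ⟨p, hp, rfl⟩ := Finset.mem_image.1 hS
    obtain ⟨h1, h2, hne, hadj⟩ := hmemQ p hp
    refine (Finset.card_le_card (t := {p, p.swap}) ?_).trans Finset.card_le_two
    intro q hq
    obtain ⟨hqQ, hqp⟩ := Finset.mem_filter.1 hq
    obtain ⟨g1, g2, gne, -⟩ := hmemQ q hqQ
    have m1 : q.1 ∈ f p := by rw [← hqp]; simp [f]
    have m2 : q.2 ∈ f p := by rw [← hqp]; simp [f]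
    have k1 : q.1 = p.1 ∨ q.1 = p.2 := by
      simp only [f, Finset.mem_insert, Finset.mem_singleton] at m1
      rcases m1 with h | h | h | h
      · exact absurd (h ▸ g1) huW
      · exact absurd (h ▸ g1) hvW
      · exact .inl h
      · exact .inr h
    have k2 : q.2 = p.1 ∨ q.2 = p.2 := by
      simp only [f, Finset.mem_insert, Finset.mem_singleton] at m2
      rcases m2 with h | h | h | h
      · exact absurd (h ▸ g2) huW
      · exact absurd (h ▸ g2) hvW
      · exact .inl h
      · exact .inr h
    simp only [Finset.mem_insert, Finset.mem_singleton, Prod.ext_iff, Prod.fst_swap, Prod.snd_swap]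
    rcases k1 with k1 | k1 <;> rcases k2 with k2 | k2
    · exact absurd (k1.trans k2.symm) gne
    · exact .inl ⟨k1, k2⟩
    · exact .inr ⟨k1, k2⟩
    · exact absurd (k1.trans k2.symm) gne
  omega

/-! ### Potentials, switching and matrix entries -/

theorem neg_one_pow_countP_edges {V : Type*} {Γ : SignedGraph V} (ε : V → ℤˣ)
    (hε : ∀ a b, Γ.graph.Adj a b → Γ.sign s(a, b) = ε a * ε b) {a b : V}
    (c : Γ.graph.Walk a b) :
    (-1 : ℤˣ) ^ (c.edges.countP (fun e => Γ.sign e = -1)) = ε a * ε b := by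
  induction c with
  | nil => simp
  | @cons a b d h q ih =>
    rw [SimpleGraph.Walk.edges_cons, List.countP_cons, pow_add, ih]
    have := hε _ _ h
    have hb : ε b * ε b = 1 := Int.units_mul_self _
    have key : (-1 : ℤˣ) ^ (if decide (Γ.sign s(a, b) = -1) = true then 1 else 0)
        = ε a * ε b := by
      rw [← this]
      rcases Int.units_eq_one_or (Γ.sign s(a, b)) with h | h <;> rw [h] <;> decide
    rw [key]
    calc ε b * ε d * (ε a * ε b) = (ε b * ε b) * (ε a * ε d) := by
          simp only [mul_comm, mul_left_comm]
      _ = ε a * ε d := by rw [hb, one_mul]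

/-- A signature given by a potential is balanced. -/
theorem balanced_of_potential {V : Type*} {Γ : SignedGraph V} (ε : V → ℤˣ)
    (hε : ∀ a b, Γ.graph.Adj a b → Γ.sign s(a, b) = ε a * ε b) : Γ.Balanced := by
  intro v c _
  have h := neg_one_pow_countP_edges ε hε c
  rw [Int.units_mul_self] at h
  by_contra hodd
  rw [Nat.not_even_iff_odd] at hodd
  rw [hodd.neg_one_pow] at h
  exact absurd h (by decide)

open Classical in
/-- The potential of a switching set: `-1` inside and `1` outside. -/
noncomputable def potential {V : Type*} (U : Set V) (a : V) : ℤˣ := if a ∈ U then -1 else 1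

theorem switch_sign {V : Type*} (Γ : SignedGraph V) (U : Set V) (a b : V) :
    (Γ.switch U).sign s(a, b) = potential U a * potential U b * Γ.sign s(a, b) := by
  by_cases ha : a ∈ U <;> by_cases hb : b ∈ U <;> simp [switch, potential, ha, hb]

/-- A step needs a nonempty proper set; for any other set switching changes nothing and the empty
chain serves. -/
theorem reachable_switch {V : Type*} (Γ : SignedGraph V) (U : Set V) :
    Relation.ReflTransGen SwitchStep Γ (Γ.switch U) := by
  by_cases h : U.Nonempty ∧ U ≠ Set.univ
  · exact .single ⟨U, h.1, h.2, rfl⟩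
  · have : Γ.switch U = Γ := by
      unfold switch
      congr 1
      funext e
      rw [if_neg]
      rintro ⟨⟨a, -, ha⟩, b, -, hb⟩
      exact h ⟨⟨a, ha⟩, fun hU => hb (hU ▸ Set.mem_univ b)⟩
    rw [this]

/-- If all edges were positive after switching, the potential of U would show Γ to be balanced. -/
theorem exists_neg_edge_switch {V : Type*} {Γ : SignedGraph V} (h : Γ.Unbalanced) (U : Set V) :
    ∃ a b, Γ.graph.Adj a b ∧ (Γ.switch U).sign s(a, b) = -1 := by
  by_contra! hcon
  refine h (balanced_of_potential (potential U) fun a b hab => ?_)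
  have h1 := (Int.units_eq_one_or _).resolve_right (hcon a b hab)
  rw [switch_sign] at h1
  rw [← inv_eq_of_mul_eq_one_right h1]
  simp [mul_comm]

theorem adjMatrix_eq_of_adj {V : Type*} {Γ : SignedGraph V} {a b : V} (h : Γ.graph.Adj a b) :
    Γ.adjMatrix a b = ((Γ.sign s(a, b) : ℤ) : ℝ) := by
  simp [adjMatrix, h]

theorem adjMatrix_eq_of_not_adj {V : Type*} {Γ : SignedGraph V} {a b : V}
    (h : ¬ Γ.graph.Adj a b) : Γ.adjMatrix a b = 0 := by
  simp [adjMatrix, h]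

theorem adjMatrix_self {V : Type*} (Γ : SignedGraph V) (a : V) : Γ.adjMatrix a a = 0 :=
  adjMatrix_eq_of_not_adj (Γ.graph.loopless.irrefl a)

theorem adjMatrix_comm {V : Type*} (Γ : SignedGraph V) (a b : V) :
    Γ.adjMatrix a b = Γ.adjMatrix b a := by
  simpa using congrFun (congrFun Γ.isHermitian_adjMatrix a) b |>.symm

/-- An entry is `0`, `1` or `-1`, according to the adjacency and the sign. -/
theorem adjMatrix_trichotomy {V : Type*} (Γ : SignedGraph V) (a b : V) :
    (¬ Γ.graph.Adj a b ∧ Γ.adjMatrix a b = 0) ∨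
    (Γ.graph.Adj a b ∧ Γ.sign s(a, b) = 1 ∧ Γ.adjMatrix a b = 1) ∨
    (Γ.graph.Adj a b ∧ Γ.sign s(a, b) = -1 ∧ Γ.adjMatrix a b = -1) := by
  by_cases h : Γ.graph.Adj a b
  · right
    rw [adjMatrix_eq_of_adj h]
    rcases Int.units_eq_one_or (Γ.sign s(a, b)) with hs | hs <;> simp [h, hs]
  · exact .inl ⟨h, adjMatrix_eq_of_not_adj h⟩

theorem adjMatrix_switch {V : Type*} (Γ : SignedGraph V) (U : Set V) (a b : V) :
    (Γ.switch U).adjMatrix a b =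
      ((potential U a : ℤ) : ℝ) * ((potential U b : ℤ) : ℝ) * Γ.adjMatrix a b := by
  by_cases h : Γ.graph.Adj a b
  · rw [adjMatrix_eq_of_adj h, adjMatrix_eq_of_adj (Γ := Γ.switch U) h, switch_sign]
    push_cast
    ring
  · rw [adjMatrix_eq_of_not_adj h, adjMatrix_eq_of_not_adj (Γ := Γ.switch U) h, mul_zero]

/-- A relabelling that matches the adjacency matrices is an isomorphism. -/
theorem isomorphic_of_adjMatrix {V W : Type*} {Γ : SignedGraph V} {Δ : SignedGraph W}
    (φ : V ≃ W) (h : ∀ a b, Γ.adjMatrix a b = Δ.adjMatrix (φ a) (φ b)) : Γ.Isomorphic Δ := by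
  refine ⟨⟨φ, fun {a b} => ?_⟩, fun a b hab => ?_⟩
  · have := h a b
    rcases Γ.adjMatrix_trichotomy a b with ⟨h1, h2⟩ | ⟨h1, -, h2⟩ | ⟨h1, -, h2⟩ <;>
    rcases Δ.adjMatrix_trichotomy (φ a) (φ b) with ⟨k1, k2⟩ | ⟨k1, -, k2⟩ | ⟨k1, -, k2⟩ <;>
    rw [h2, k2] at this <;> first | (norm_num at this; done) | simp [h1, k1]
  · have := h a b
    rcases Γ.adjMatrix_trichotomy a b with ⟨h1, h2⟩ | ⟨h1, hs, h2⟩ | ⟨h1, hs, h2⟩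
    · exact absurd hab h1
    all_goals
      rcases Δ.adjMatrix_trichotomy (φ a) (φ b) with ⟨k1, k2⟩ | ⟨k1, ks, k2⟩ | ⟨k1, ks, k2⟩ <;>
      rw [h2, k2] at this <;>
      first | (norm_num at this; done) | exact ks.trans hs.symm

theorem adjMatrix_of_iso {V W : Type*} {Γ : SignedGraph V} {Δ : SignedGraph W}
    (f : Γ.graph ≃g Δ.graph)
    (hf : ∀ a b, Γ.graph.Adj a b → Δ.sign s(f a, f b) = Γ.sign s(a, b)) (a b : V) :
    Γ.adjMatrix a b = Δ.adjMatrix (f a) (f b) := by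
  by_cases h : Γ.graph.Adj a b
  · rw [adjMatrix_eq_of_adj h, adjMatrix_eq_of_adj (f.map_adj_iff.2 h), hf a b h]
  · rw [adjMatrix_eq_of_not_adj h, adjMatrix_eq_of_not_adj fun h' => h (f.map_adj_iff.1 h')]

end SignedGraph

/-! ### Rayleigh quotients and invariance of the spectral radius -/

/-- The quadratic form of a symmetric matrix is diagonal in an eigenvector basis. -/
theorem Matrix.IsHermitian.exists_diagonal_form {V : Type*} [Fintype V] [DecidableEq V]
    {A : Matrix V V ℝ} (hA : A.IsHermitian) (x : V → ℝ) :
    ∃ c : V → ℝ, x ⬝ᵥ x = ∑ i, c i ^ 2 ∧ x ⬝ᵥ (A *ᵥ x) = ∑ i, hA.eigenvalues i * c i ^ 2 := by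
  let b := hA.eigenvectorBasis
  let X : EuclideanSpace ℝ V := WithLp.toLp 2 x
  let Y : EuclideanSpace ℝ V := WithLp.toLp 2 (A *ᵥ x)
  have hinner : ∀ z w : EuclideanSpace ℝ V, inner ℝ z w = (w : V → ℝ) ⬝ᵥ (z : V → ℝ) := by
    intro z w
    rw [EuclideanSpace.inner_eq_star_dotProduct]
    simp
  have hbY : ∀ i, inner ℝ (b i) Y = hA.eigenvalues i * inner ℝ (b i) X := by
    intro i
    rw [hinner, hinner]
    change (A *ᵥ x) ⬝ᵥ (b i : V → ℝ) = _ * (x ⬝ᵥ (b i : V → ℝ))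
    have hT : A.IsSymm := by simpa using hA
    have h1 : A *ᵥ (b i : V → ℝ) = hA.eigenvalues i • (b i : V → ℝ) := by
      simpa using hA.mulVec_eigenvectorBasis i
    rw [dotProduct_comm, dotProduct_mulVec, ← mulVec_transpose, hT.eq, h1, smul_dotProduct,
      dotProduct_comm, smul_eq_mul]
  have e1 : x ⬝ᵥ (A *ᵥ x) = ∑ i, inner ℝ X (b i) * inner ℝ (b i) Y := by
    rw [b.sum_inner_mul_inner, hinner, dotProduct_comm]
  have e2 : x ⬝ᵥ x = ∑ i, inner ℝ X (b i) * inner ℝ (b i) X := by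
    rw [b.sum_inner_mul_inner, hinner]
  refine ⟨fun i => inner ℝ X (b i), ?_, ?_⟩
  · rw [e2]
    refine Finset.sum_congr rfl fun i _ => ?_
    rw [real_inner_comm X (b i)]
    ring
  · rw [e1]
    refine Finset.sum_congr rfl fun i _ => ?_
    rw [hbY, real_inner_comm X (b i)]
    ring

namespace SignedGraph

section

variable {V : Type*} [Fintype V] [DecidableEq V] (Γ : SignedGraph V)

theorem dotProduct_mulVec_le_spectralRadius (x : V → ℝ) :
    x ⬝ᵥ (Γ.adjMatrix *ᵥ x) ≤ Γ.spectralRadius * (x ⬝ᵥ x) := by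
  obtain ⟨c, h1, h2⟩ := Γ.isHermitian_adjMatrix.exists_diagonal_form x
  rw [h1, h2, Finset.mul_sum]
  refine Finset.sum_le_sum fun i _ => mul_le_mul_of_nonneg_right ?_ (sq_nonneg _)
  exact (le_ciSup (Set.finite_range _).bddAbove i).trans (le_max_left _ _)

theorem neg_dotProduct_mulVec_le_spectralRadius (x : V → ℝ) :
    -(x ⬝ᵥ (Γ.adjMatrix *ᵥ x)) ≤ Γ.spectralRadius * (x ⬝ᵥ x) := by
  obtain ⟨c, h1, h2⟩ := Γ.isHermitian_adjMatrix.exists_diagonal_form x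
  rw [h1, h2, Finset.mul_sum, ← Finset.sum_neg_distrib]
  refine Finset.sum_le_sum fun i _ => ?_
  rw [← neg_mul]
  refine mul_le_mul_of_nonneg_right ?_ (sq_nonneg _)
  exact (neg_le_neg (ciInf_le (Set.finite_range _).bddBelow i)).trans (le_max_right _ _)

/-- The spectral radius is attained by an eigenvector of the adjacency matrix or its negative. -/
theorem exists_eigenvector [Nonempty V] :
    ∃ x : V → ℝ, x ⬝ᵥ x = 1 ∧ (Γ.adjMatrix *ᵥ x = Γ.spectralRadius • x ∨
      Γ.adjMatrix *ᵥ x = (-Γ.spectralRadius) • x) := by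
  have key : ∀ i, ∃ x : V → ℝ, x ⬝ᵥ x = 1 ∧
      Γ.adjMatrix *ᵥ x = Γ.isHermitian_adjMatrix.eigenvalues i • x := by
    intro i
    refine ⟨(Γ.isHermitian_adjMatrix.eigenvectorBasis i : V → ℝ), ?_, ?_⟩
    · have h := (Γ.isHermitian_adjMatrix.eigenvectorBasis).orthonormal.1 i
      have h2 := real_inner_self_eq_norm_sq (Γ.isHermitian_adjMatrix.eigenvectorBasis i)
      rw [h, EuclideanSpace.inner_eq_star_dotProduct] at h2
      simpa using h2
    · simpa using Γ.isHermitian_adjMatrix.mulVec_eigenvectorBasis i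
  rcases le_total (-Γ.leastEigenvalue) Γ.index with h | h
  · obtain ⟨i, hi⟩ := exists_eq_ciSup_of_finite (f := Γ.isHermitian_adjMatrix.eigenvalues)
    obtain ⟨x, h1, h2⟩ := key i
    refine ⟨x, h1, .inl ?_⟩
    rw [spectralRadius, max_eq_left h, h2, hi]; rfl
  · obtain ⟨i, hi⟩ := exists_eq_ciInf_of_finite (f := Γ.isHermitian_adjMatrix.eigenvalues)
    obtain ⟨x, h1, h2⟩ := key i
    refine ⟨x, h1, .inr ?_⟩
    rw [spectralRadius, max_eq_right h, h2, hi, neg_neg]; rfl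

/-- A vector attaining the spectral radius in the quadratic form is an eigenvector. -/
theorem mulVec_eq_of_dotProduct_eq {x : V → ℝ}
    (h : Γ.spectralRadius * (x ⬝ᵥ x) ≤ x ⬝ᵥ (Γ.adjMatrix *ᵥ x)) :
    Γ.adjMatrix *ᵥ x = Γ.spectralRadius • x := by
  have hquad : ∀ z : V → ℝ, z ⬝ᵥ ((Γ.spectralRadius • (1 : Matrix V V ℝ) - Γ.adjMatrix) *ᵥ z) =
      Γ.spectralRadius * (z ⬝ᵥ z) - z ⬝ᵥ (Γ.adjMatrix *ᵥ z) := by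
    intro z
    rw [sub_mulVec, smul_mulVec, one_mulVec, dotProduct_sub, dotProduct_smul, smul_eq_mul]
  -- The form of the positive semidefinite matrix ρI - A vanishes only on its kernel.
  have hpsd : (Γ.spectralRadius • (1 : Matrix V V ℝ) - Γ.adjMatrix).PosSemidef := by
    refine PosSemidef.of_dotProduct_mulVec_nonneg ?_ fun z => ?_
    · refine IsHermitian.sub ?_ Γ.isHermitian_adjMatrix
      simp [IsHermitian]
    · rw [star_trivial, hquad]
      linarith [Γ.dotProduct_mulVec_le_spectralRadius z]
  have h0 := (hpsd.dotProduct_mulVec_zero_iff x).1 (by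
    rw [star_trivial, hquad]
    linarith [Γ.dotProduct_mulVec_le_spectralRadius x])
  rw [sub_mulVec, smul_mulVec, one_mulVec, sub_eq_zero] at h0
  exact h0.symm

end

theorem dotProduct_mulVec_eq_sum {V : Type*} [Fintype V] (A : Matrix V V ℝ) (x : V → ℝ) :
    x ⬝ᵥ (A *ᵥ x) = ∑ i, ∑ j, A i j * x i * x j := by
  simp only [dotProduct, mulVec, Finset.mul_sum]
  exact Finset.sum_congr rfl fun i _ => Finset.sum_congr rfl fun j _ => by ring

/-- Monotonicity of the spectral radius under signed relabelling. -/
theorem spectralRadius_le_of_signed_equiv {V W : Type*} [Fintype V] [DecidableEq V] [Nonempty V]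
    [Fintype W] [DecidableEq W] {Γ : SignedGraph V} {Δ : SignedGraph W} (φ : V ≃ W) (ε : V → ℝ)
    (hε : ∀ a, ε a * ε a = 1)
    (h : ∀ a b, Γ.adjMatrix a b = ε a * ε b * Δ.adjMatrix (φ a) (φ b)) :
    Γ.spectralRadius ≤ Δ.spectralRadius := by
  obtain ⟨x, hx, hx'⟩ := Γ.exists_eigenvector
  let z : W → ℝ := fun w => ε (φ.symm w) * x (φ.symm w)
  have hz : z ⬝ᵥ z = 1 := by
    rw [← hx]
    simp only [dotProduct, z]
    rw [← φ.sum_comp]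
    refine Finset.sum_congr rfl fun a _ => ?_
    rw [φ.symm_apply_apply]
    linear_combination (x a * x a) * hε a
  have hq : z ⬝ᵥ (Δ.adjMatrix *ᵥ z) = x ⬝ᵥ (Γ.adjMatrix *ᵥ x) := by
    rw [dotProduct_mulVec_eq_sum, dotProduct_mulVec_eq_sum, ← φ.sum_comp]
    refine Finset.sum_congr rfl fun a _ => ?_
    rw [← φ.sum_comp]
    refine Finset.sum_congr rfl fun b _ => ?_
    simp only [z, φ.symm_apply_apply, h]
    ring
  have h1 := Δ.dotProduct_mulVec_le_spectralRadius z
  have h2 := Δ.neg_dotProduct_mulVec_le_spectralRadius z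
  rw [hq, hz] at h1 h2
  rcases hx' with h' | h' <;> rw [h', dotProduct_smul, hx, smul_eq_mul] at h1 h2 <;> linarith

theorem spectralRadius_eq_of_signed_equiv {V W : Type*} [Fintype V] [DecidableEq V] [Nonempty V]
    [Fintype W] [DecidableEq W] {Γ : SignedGraph V} {Δ : SignedGraph W} (φ : V ≃ W) (ε : V → ℝ)
    (hε : ∀ a, ε a * ε a = 1)
    (h : ∀ a b, Γ.adjMatrix a b = ε a * ε b * Δ.adjMatrix (φ a) (φ b)) :
    Γ.spectralRadius = Δ.spectralRadius := by
  have : Nonempty W := φ.symm.nonempty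
  refine le_antisymm (spectralRadius_le_of_signed_equiv φ ε hε h)
    (spectralRadius_le_of_signed_equiv φ.symm (fun w => ε (φ.symm w)) (fun w => hε _) ?_)
  intro a b
  rw [h, φ.apply_symm_apply, φ.apply_symm_apply]
  linear_combination (-(ε (φ.symm b) * ε (φ.symm b)) * Δ.adjMatrix a b) * hε (φ.symm a) -
    Δ.adjMatrix a b * hε (φ.symm b)

theorem potential_mul_self {V : Type*} (U : Set V) (a : V) :
    ((potential U a : ℤ) : ℝ) * ((potential U a : ℤ) : ℝ) = 1 := by
  by_cases h : a ∈ U <;> simp [potential, h]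

theorem spectralRadius_switch {V : Type*} [Fintype V] [DecidableEq V] [Nonempty V]
    (Γ : SignedGraph V) (U : Set V) : (Γ.switch U).spectralRadius = Γ.spectralRadius :=
  spectralRadius_eq_of_signed_equiv (Equiv.refl V) _ (potential_mul_self U)
    (Γ.adjMatrix_switch U)

theorem spectralRadius_eq_of_switchingEquivalent {V W : Type*} [Fintype V] [DecidableEq V]
    [Nonempty V] [Fintype W] [DecidableEq W] {Γ : SignedGraph V} {Δ : SignedGraph W}
    (h : Γ.SwitchingEquivalent Δ) : Γ.spectralRadius = Δ.spectralRadius := by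
  obtain ⟨Γ', hr, f, hf⟩ := h
  have h1 : Γ'.spectralRadius = Δ.spectralRadius :=
    spectralRadius_eq_of_signed_equiv f.toEquiv (fun _ => 1) (fun _ => one_mul 1)
      fun a b => by simpa using adjMatrix_of_iso f hf a b
  rw [← h1]
  clear h1 hf f
  induction hr with
  | refl => rfl
  | tail _ hs ih =>
    obtain ⟨U, -, -, rfl⟩ := hs
    rw [ih, spectralRadius_switch]

end SignedGraph

/-! ### Coordinates of the eigenvector of a nearly complete matrix -/

/-- `y` is a nonnegative eigenvector, of squared norm the order, of a symmetric matrix with zero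
diagonal and entries in `[-1, 1]`, for an eigenvalue exceeding the order minus two. -/
structure NearComplete {V : Type*} [Fintype V] (A : Matrix V V ℝ) (y : V → ℝ) (lam : ℝ) :
    Prop where
  symm : ∀ i j, A i j = A j i
  diag : ∀ i, A i i = 0
  le_one : ∀ i j, A i j ≤ 1
  neg_one_le : ∀ i j, -1 ≤ A i j
  nonneg : ∀ i, 0 ≤ y i
  norm : ∑ i, y i ^ 2 = Fintype.card V
  eigen : ∀ i, ∑ j, A i j * y j = lam * y i
  lt : (Fintype.card V : ℝ) - 2 < lam
  large : 100000 ≤ Fintype.card V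

/-- The difference between the adjacency matrix of the complete graph and `A`. -/
def defect {V : Type*} [DecidableEq V] (A : Matrix V V ℝ) (i j : V) : ℝ :=
  if i = j then 0 else 1 - A i j

namespace NearComplete

theorem large_real {V : Type*} [Fintype V] {A : Matrix V V ℝ} {y : V → ℝ} {lam : ℝ}
    (h : NearComplete A y lam) : (100000 : ℝ) ≤ Fintype.card V := by
  exact_mod_cast h.large

theorem sum_le_card {V : Type*} [Fintype V] {A : Matrix V V ℝ} {y : V → ℝ} {lam : ℝ}
    (h : NearComplete A y lam) : ∑ j, y j ≤ Fintype.card V := by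
  have h1 := sq_sum_le_card_mul_sum_sq (s := Finset.univ) (f := y)
  rw [h.norm, Finset.card_univ] at h1
  have := h.large_real
  nlinarith

variable {V : Type*} [Fintype V] [DecidableEq V] {A : Matrix V V ℝ} {y : V → ℝ} {lam : ℝ}

theorem defect_comm (h : NearComplete A y lam) (i j : V) : defect A i j = defect A j i := by
  unfold defect
  by_cases hij : i = j
  · simp [hij]
  · rw [if_neg hij, if_neg (Ne.symm hij), h.symm]

theorem defect_nonneg (h : NearComplete A y lam) (i j : V) : 0 ≤ defect A i j := by
  unfold defect
  split_ifs
  · exact le_rfl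
  · linarith [h.le_one i j]

theorem defect_le (h : NearComplete A y lam) (i j : V) : defect A i j ≤ 2 := by
  unfold defect
  split_ifs
  · norm_num
  · linarith [h.neg_one_le i j]

theorem sum_defect (h : NearComplete A y lam) (i : V) :
    ∑ j, defect A i j * y j = ∑ j, y j - (lam + 1) * y i := by
  have h1 : ∀ j, defect A i j * y j = y j - A i j * y j - if i = j then y j else 0 := by
    intro j
    unfold defect
    split_ifs with hij
    · subst hij; rw [h.diag]; ring
    · ring
  simp only [h1, Finset.sum_sub_distrib, h.eigen, Finset.sum_ite_eq, Finset.mem_univ, if_true]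
  ring

theorem total_defect (h : NearComplete A y lam) :
    ∑ i, ∑ j, defect A i j * y i * y j =
      (∑ j, y j) ^ 2 - (lam + 1) * Fintype.card V := by
  have h1 : ∀ i, ∑ j, defect A i j * y i * y j
      = (∑ j, y j) * y i - (lam + 1) * y i ^ 2 := by
    intro i
    have : ∀ j, defect A i j * y i * y j = y i * (defect A i j * y j) := fun j => by ring
    simp only [this, ← Finset.mul_sum, h.sum_defect]
    ring
  simp only [h1, Finset.sum_sub_distrib, ← Finset.mul_sum, h.norm]
  ring

theorem term_nonneg (h : NearComplete A y lam) (i j : V) : 0 ≤ defect A i j * y i * y j :=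
  mul_nonneg (mul_nonneg (h.defect_nonneg i j) (h.nonneg i)) (h.nonneg j)

theorem total_defect_nonneg (h : NearComplete A y lam) :
    0 ≤ ∑ i, ∑ j, defect A i j * y i * y j :=
  Finset.sum_nonneg fun i _ => Finset.sum_nonneg fun j _ => h.term_nonneg i j

/-- Cauchy–Schwarz gives (Σy)² ≤ n², and λ+1 > n-1, leaving less than n² - (n-1)n. -/
theorem total_defect_lt (h : NearComplete A y lam) :
    ∑ i, ∑ j, defect A i j * y i * y j < Fintype.card V := by
  have h1 := sq_sum_le_card_mul_sum_sq (s := Finset.univ) (f := y)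
  rw [h.norm, Finset.card_univ] at h1
  have := h.large_real
  have := h.lt
  rw [h.total_defect]
  nlinarith

/-- The weighted row sum Σy - (λ+1)y_i of the defect is nonnegative, so y_i ≤ n/(n-1). -/
theorem le_of_large (h : NearComplete A y lam) (i : V) : y i ≤ 1.001 := by
  have h1 : 0 ≤ ∑ j, defect A i j * y j :=
    Finset.sum_nonneg fun j _ => mul_nonneg (h.defect_nonneg i j) (h.nonneg j)
  rw [h.sum_defect] at h1
  have h2 := h.sum_le_card
  have h3 := h.lt
  have h4 := h.large_real
  have h5 := h.nonneg i
  by_contra! h6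
  nlinarith

/-- Cauchy–Schwarz on the complement of a set of vertices. -/
theorem sq_sum_sub_le (h : NearComplete A y lam) (T : Finset V) :
    (∑ j, y j - ∑ j ∈ T, y j) ^ 2 ≤
      ((Fintype.card V : ℝ) - T.card) * (Fintype.card V - ∑ j ∈ T, y j ^ 2) := by
  have h1 := sq_sum_le_card_mul_sum_sq (s := Tᶜ) (f := y)
  have e1 := Finset.sum_add_sum_compl T y
  have e2 := Finset.sum_add_sum_compl T fun j => y j ^ 2
  have e3 : ((Tᶜ.card : ℕ) : ℝ) = Fintype.card V - T.card := by
    rw [Finset.card_compl, Nat.cast_sub (Finset.card_le_univ T)]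
  rw [h.norm] at e2
  rw [e3, show ∑ j ∈ Tᶜ, y j = ∑ j, y j - ∑ j ∈ T, y j by linarith,
    show ∑ j ∈ Tᶜ, y j ^ 2 = Fintype.card V - ∑ j ∈ T, y j ^ 2 by linarith] at h1
  exact h1

/-- A zero coordinate would give (Σy)² ≤ (n-1)n by Cauchy–Schwarz on the others, but nonnegativity
of the total defect gives (Σy)² ≥ (λ+1)n > (n-1)n. -/
theorem pos (h : NearComplete A y lam) (i : V) : 0 < y i := by
  refine lt_of_le_of_ne (h.nonneg i) fun h0 => ?_
  have h1 := h.sq_sum_sub_le {i}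
  simp only [Finset.sum_singleton, ← h0, Finset.card_singleton] at h1
  have h2 := h.total_defect_nonneg
  rw [h.total_defect] at h2
  have := h.lt
  have := h.large_real
  push_cast at h1
  nlinarith

/-- The sum of the defect over the rows and columns indexed by `T`. -/
theorem le_total_defect (h : NearComplete A y lam) (T : Finset V) :
    2 * ∑ i ∈ T, y i * (∑ j, y j - (lam + 1) * y i) -
      ∑ i ∈ T, ∑ j ∈ T, defect A i j * y i * y j ≤ ∑ i, ∑ j, defect A i j * y i * y j := by
  -- The rows and the columns of T have equal sums by symmetry and overlap exactly in T × T; all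
  -- remaining entries are nonnegative.
  set b : V → V → ℝ := fun i j => defect A i j * y i * y j with hb
  have hrow : ∀ i, ∑ j, b i j = y i * (∑ j, y j - (lam + 1) * y i) := by
    intro i
    rw [← h.sum_defect, Finset.mul_sum]
    exact Finset.sum_congr rfl fun j _ => by simp only [hb]; ring
  have hsym : ∀ i j, b i j = b j i := fun i j => by
    simp only [hb]; rw [h.defect_comm]; ring
  have e1 := Finset.sum_add_sum_compl T fun i => ∑ j, b i j
  have e2 := Finset.sum_add_sum_compl T fun i => ∑ j ∈ T, b i j
  have e3 : ∑ i, ∑ j ∈ T, b i j = ∑ i ∈ T, ∑ j, b i j := by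
    rw [Finset.sum_comm]
    exact Finset.sum_congr rfl fun i _ => Finset.sum_congr rfl fun j _ => hsym _ _
  have e4 : ∑ i ∈ Tᶜ, ∑ j ∈ T, b i j ≤ ∑ i ∈ Tᶜ, ∑ j, b i j :=
    Finset.sum_le_sum fun i _ => Finset.sum_le_sum_of_subset_of_nonneg (Finset.subset_univ _)
      fun j _ _ => h.term_nonneg i j
  have e5 : ∑ i ∈ T, y i * (∑ j, y j - (lam + 1) * y i) = ∑ i ∈ T, ∑ j, b i j :=
    Finset.sum_congr rfl fun i _ => (hrow i).symm
  rw [e5]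
  linarith

/-- Any few coordinates have almost full squared sum, up to one. -/
theorem card_sub_le_sum_sq (h : NearComplete A y lam) (T : Finset V) (hT : T.card ≤ 3) :
    (T.card : ℝ) - 1 - 0.001 ≤ ∑ i ∈ T, y i ^ 2 := by
  have h1 := h.le_total_defect T
  have h2 := h.sq_sum_sub_le T
  -- At most nine entries, each at most 2·1.001² < 2.1.
  have h3 : ∑ i ∈ T, ∑ j ∈ T, defect A i j * y i * y j ≤ 19 := by
    have : ∀ i ∈ T, ∑ j ∈ T, defect A i j * y i * y j ≤ T.card • (2.1 : ℝ) := fun i _ =>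
      Finset.sum_le_card_nsmul _ _ _ fun j _ => by
        have a1 := h.le_of_large i
        have a2 := h.le_of_large j
        have a3 := h.nonneg i
        have a4 := h.nonneg j
        have a5 : y i * y j ≤ 1.001 * 1.001 := mul_le_mul a1 a2 a4 (by norm_num)
        have a6 := h.defect_le i j
        have a7 : 0 ≤ y i * y j := mul_nonneg a3 a4
        nlinarith
    have := Finset.sum_le_card_nsmul T _ _ this
    have hc : (T.card : ℝ) ≤ 3 := by exact_mod_cast hT
    have hc0 : (0 : ℝ) ≤ T.card := Nat.cast_nonneg _
    simp only [nsmul_eq_mul] at this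
    nlinarith
  have h4 : ∑ i ∈ T, y i * (∑ j, y j - (lam + 1) * y i) =
      (∑ j, y j) * ∑ i ∈ T, y i - (lam + 1) * ∑ i ∈ T, y i ^ 2 := by
    rw [Finset.mul_sum, Finset.mul_sum, ← Finset.sum_sub_distrib]
    exact Finset.sum_congr rfl fun i _ => by ring
  rw [h4, h.total_defect] at h1
  have h5 := h.large_real
  have h6 := h.lt
  have hc : (T.card : ℝ) ≤ 3 := by exact_mod_cast hT
  have hc0 : (0 : ℝ) ≤ T.card := Nat.cast_nonneg _
  have hq0 : 0 ≤ ∑ i ∈ T, y i ^ 2 := Finset.sum_nonneg fun i _ => sq_nonneg _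
  generalize ∑ i ∈ T, ∑ j ∈ T, defect A i j * y i * y j = d at *
  generalize ∑ i ∈ T, y i ^ 2 = q at *
  generalize ∑ i ∈ T, y i = p at *
  generalize ∑ j, y j = S at *
  generalize (Fintype.card V : ℝ) = n at *
  generalize (T.card : ℝ) = τ at *
  by_contra! hcon
  -- `h1` bounds (λ+1)(n-2q) by (S-p)² - p² + 19, and `h2` bounds (S-p)² by (n-τ)(n-q). With λ+1 >
  -- n-1 the n² terms cancel, leaving `k3`, which fails for large n.
  have k1 : (lam + 1) * (n - 2 * q) ≤ 19 - p ^ 2 + n ^ 2 - n * q - τ * n + τ * q := by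
    nlinarith
  have k2 : (n - 1) * (n - 2 * q) ≤ (lam + 1) * (n - 2 * q) :=
    mul_le_mul_of_nonneg_right (by linarith) (by linarith)
  have k3 : n * (τ - 1 - q) ≤ 19 + (τ - 2) * q := by nlinarith [sq_nonneg p]
  have k4 : (τ - 2) * q ≤ 1 * q := mul_le_mul_of_nonneg_right (by linarith) hq0
  have k5 : 100000 * (0.001 : ℝ) ≤ n * (τ - 1 - q) :=
    mul_le_mul h5 (by linarith) (by norm_num) (by linarith)
  linarith

/-- Two squares sum to at least 0.999, so the larger is at least 0.4995 > 0.7². -/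
theorem ge_of_ne_min (h : NearComplete A y lam) {w : V} (hw : ∀ i, y w ≤ y i) {a : V}
    (ha : a ≠ w) : 0.7 ≤ y a := by
  have h1 := h.card_sub_le_sum_sq {a, w} (Finset.card_le_two.trans (by norm_num))
  rw [Finset.sum_pair ha, Finset.card_pair ha] at h1
  have h2 := hw a
  have h3 := h.nonneg w
  push_cast at h1
  by_contra! h4
  nlinarith

/-- For y_a ≤ y_b, the bound on three squares and minimality of y_w give 2y_a² + y_b² ≥ 1.999.
Multiplying two bounds 0.7 gives only 0.49, too weak for the later comparison 4·0.6 > 2·1.001². -/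
theorem mul_ge_of_ne_min (h : NearComplete A y lam) {w : V} (hw : ∀ i, y w ≤ y i) {a b : V}
    (ha : a ≠ w) (hb : b ≠ w) (hab : a ≠ b) : 0.6 ≤ y a * y b := by
  wlog hle : y a ≤ y b generalizing a b
  · rw [mul_comm]
    exact this hb ha hab.symm (le_of_not_ge hle)
  have h1 := h.card_sub_le_sum_sq {a, b, w} Finset.card_le_three
  rw [Finset.card_eq_three.2 ⟨a, b, w, hab, ha, hb, rfl⟩, Finset.sum_insert (by simp [ha, hab]),
    Finset.sum_pair hb] at h1
  have h2 := hw a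
  have h3 := h.nonneg w
  have h4 := h.ge_of_ne_min hw ha
  push_cast at h1
  have h5 : y w ^ 2 ≤ y a ^ 2 := pow_le_pow_left₀ h3 h2 2
  have h6 : 0.7 ≤ y b := h4.trans hle
  rcases le_or_gt 0.8 (y a) with h7 | h7
  · nlinarith
  · have h8 : 0.715 ≤ y b ^ 2 := by nlinarith
    have h9 : (0.6 : ℝ) ^ 2 ≤ (y a * y b) ^ 2 := by
      rw [mul_pow]
      have : 0.49 ≤ y a ^ 2 := by nlinarith
      have : y a ^ 2 ≤ 0.64 := by nlinarith
      nlinarith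
    exact (pow_le_pow_iff_left₀ (by norm_num) (by positivity) two_ne_zero).1 h9

end NearComplete

/-! ### Copies of Γ_{r,n} on a given vertex set -/

namespace SignedGraph

/-- The difference between the complete graph and the graph in which `v` misses the vertices of `M`
and `uv` is the only negative edge. -/
def gamDefect {V : Type*} [DecidableEq V] (u v : V) (M : Finset V) (i j : V) : ℝ :=
  (if i = u ∧ j = v then 2 else 0) + (if i = v ∧ j = u then 2 else 0) +
    (if i = v ∧ j ∈ M then 1 else 0) + (if i ∈ M ∧ j = v then 1 else 0)

theorem gamDefect_self {V : Type*} [DecidableEq V] {u v : V} (huv : u ≠ v) {M : Finset V}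
    (hvM : v ∉ M) (i : V) : gamDefect u v M i i = 0 := by
  unfold gamDefect
  rw [if_neg, if_neg, if_neg, if_neg]
  · norm_num
  · rintro ⟨h1, rfl⟩; exact hvM h1
  · rintro ⟨rfl, h1⟩; exact hvM h1
  · rintro ⟨rfl, h1⟩; exact huv h1.symm
  · rintro ⟨rfl, h1⟩; exact huv h1

theorem sum_gamDefect {V : Type*} [Fintype V] [DecidableEq V] (u v : V) (M : Finset V)
    (y : V → ℝ) (i : V) : ∑ j, gamDefect u v M i j * y j =
      (if i = u then 2 * y v else 0) + (if i = v then 2 * y u else 0) +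
        (if i = v then ∑ j ∈ M, y j else 0) + (if i ∈ M then y v else 0) := by
  simp only [gamDefect, add_mul, Finset.sum_add_distrib, ite_and, ite_mul, zero_mul, one_mul]
  congr 1
  · congr 1
    · congr 1
      · split_ifs <;> simp
      · split_ifs <;> simp
    · split_ifs <;> simp
  · split_ifs <;> simp

theorem total_gamDefect {V : Type*} [Fintype V] [DecidableEq V] (u v : V) (M : Finset V)
    (y : V → ℝ) : ∑ i, ∑ j, gamDefect u v M i j * y i * y j =
      4 * y u * y v + 2 * y v * ∑ j ∈ M, y j := by
  have h : ∀ i, ∑ j, gamDefect u v M i j * y i * y j =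
      (if i = u then 2 * y v * y i else 0) + (if i = v then 2 * y u * y i else 0) +
        (if i = v then (∑ j ∈ M, y j) * y i else 0) + (if i ∈ M then y v * y i else 0) := by
    intro i
    have : ∀ j, gamDefect u v M i j * y i * y j = gamDefect u v M i j * y j * y i :=
      fun j => by ring
    simp only [this, ← Finset.sum_mul, sum_gamDefect, add_mul, ite_mul, zero_mul]
  simp only [h, Finset.sum_add_distrib, Finset.sum_ite_eq', Finset.mem_univ, if_true,
    Finset.sum_ite_mem, Finset.univ_inter, ← Finset.mul_sum]
  ring

theorem gam_sign {r n : ℕ} (p q : Fin n) : (Gam r n).sign s(p, q) =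
    if (p.val = 0 ∧ q.val + 1 = n) ∨ (q.val = 0 ∧ p.val + 1 = n) then -1 else 1 := by
  have : (∃ i j : Fin n, i.val = 0 ∧ j.val + 1 = n ∧ s(p, q) = s(i, j)) ↔
      (p.val = 0 ∧ q.val + 1 = n) ∨ (q.val = 0 ∧ p.val + 1 = n) := by
    constructor
    · rintro ⟨i, j, hi, hj, h⟩
      rcases Sym2.eq_iff.1 h with ⟨rfl, rfl⟩ | ⟨rfl, rfl⟩
      · exact .inl ⟨hi, hj⟩
      · exact .inr ⟨hi, hj⟩
    · rintro (⟨h1, h2⟩ | ⟨h1, h2⟩)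
      · exact ⟨p, q, h1, h2, rfl⟩
      · exact ⟨q, p, h1, h2, Sym2.eq_swap⟩
  simp only [Gam, this]

theorem gam_adjMatrix {V : Type*} [DecidableEq V] {r n : ℕ} (hr : r + 2 ≤ n) {u v : V}
    {M : Finset V} (φ : V ≃ Fin n) (hu : ∀ i, i = u ↔ (φ i).val = 0)
    (hv : ∀ i, i = v ↔ (φ i).val + 1 = n)
    (hM : ∀ i, i ∈ M ↔ r + 1 ≤ (φ i).val ∧ (φ i).val + 1 < n) {i j : V} (hij : i ≠ j) :
    (Gam r n).adjMatrix (φ i) (φ j) = 1 - gamDefect u v M i j := by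
  have hne : φ i ≠ φ j := fun h => hij (φ.injective h)
  have hne' : (φ i).val ≠ (φ j).val := fun h => hne (Fin.ext h)
  have hi := (φ i).isLt
  have hj := (φ j).isLt
  by_cases hadj : (Gam r n).graph.Adj (φ i) (φ j)
  · rw [adjMatrix_eq_of_adj hadj, gam_sign]
    simp only [gamDefect, hu, hv, hM]
    obtain ⟨-, h1, h2⟩ := hadj
    generalize (φ i).val = p at *
    generalize (φ j).val = q at *
    split_ifs <;> first | omega | norm_num
  · rw [adjMatrix_eq_of_not_adj hadj]
    simp only [gamDefect, hu, hv, hM]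
    have hadj' : ¬ (((φ i).val + 1 = n → (φ j).val < r + 1) ∧
      ((φ j).val + 1 = n → (φ i).val < r + 1)) := fun h => hadj ⟨hne, h⟩
    generalize (φ i).val = p at *
    generalize (φ j).val = q at *
    split_ifs <;> first | omega | norm_num

/-- The matrix of the copy is J - I minus `gamDefect`, so its form at y can be compared with that of
Γ at the same y. -/
theorem gam_dotProduct {V : Type*} [Fintype V] [DecidableEq V] {r n : ℕ} (hr : r + 2 ≤ n)
    {u v : V} (huv : u ≠ v) {M : Finset V} (hvM : v ∉ M)
    (φ : V ≃ Fin n) (hu : ∀ i, i = u ↔ (φ i).val = 0)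
    (hv : ∀ i, i = v ↔ (φ i).val + 1 = n)
    (hM : ∀ i, i ∈ M ↔ r + 1 ≤ (φ i).val ∧ (φ i).val + 1 < n) (y : V → ℝ) :
    (y ∘ φ.symm) ⬝ᵥ ((Gam r n).adjMatrix *ᵥ (y ∘ φ.symm)) =
      (∑ i, y i) ^ 2 - ∑ i, y i ^ 2 - (4 * y u * y v + 2 * y v * ∑ j ∈ M, y j) := by
  rw [dotProduct_mulVec_eq_sum, ← φ.sum_comp, ← total_gamDefect, sq, Finset.sum_mul_sum,
    ← Finset.sum_sub_distrib, ← Finset.sum_sub_distrib]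
  refine Finset.sum_congr rfl fun i _ => ?_
  rw [← φ.sum_comp]
  have h1 : y i ^ 2 = ∑ j, if i = j then y i * y j else 0 := by simp [sq]
  rw [h1, ← Finset.sum_sub_distrib, ← Finset.sum_sub_distrib]
  refine Finset.sum_congr rfl fun j _ => ?_
  simp only [Function.comp, φ.symm_apply_apply]
  by_cases hij : i = j
  · subst hij
    have h0 := gamDefect_self huv hvM i
    rw [adjMatrix_self, if_pos rfl, h0]
    ring
  · rw [gam_adjMatrix hr φ hu hv hM hij, if_neg hij]
    ring

theorem card_filter_gam {r n : ℕ} (hr : r + 2 ≤ n) :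
    (Finset.univ.filter fun w : Fin n => r + 1 ≤ w.val ∧ w.val + 1 < n).card = n - 2 - r := by
  rw [← Finset.card_map Fin.valEmbedding]
  have : (Finset.univ.filter fun w : Fin n => r + 1 ≤ w.val ∧ w.val + 1 < n).map
      Fin.valEmbedding = Finset.Ico (r + 1) (n - 1) := by
    ext a
    simp only [Finset.mem_map, Finset.mem_filter, Finset.mem_univ, true_and, Finset.mem_Ico,
      Fin.valEmbedding_apply]
    constructor
    · rintro ⟨b, hb, rfl⟩
      omega
    · intro h
      exact ⟨⟨a, by omega⟩, by simp only; omega, rfl⟩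
  rw [this, Nat.card_Ico]
  omega

/-- The clique on n-1 vertices already has index n-2. The row of vₙ sums to r-1 > 0, so giving vₙ
the weight e = 1/n gains 2e(r-1) against a loss of (n-2)e². -/
theorem spectralRadius_gam_gt {r n : ℕ} (hr : 2 ≤ r) (hn : r + 2 ≤ n) :
    (n : ℝ) - 2 < (Gam r n).spectralRadius := by
  let u : Fin n := ⟨0, by omega⟩
  let v : Fin n := ⟨n - 1, by omega⟩
  let M := Finset.univ.filter fun w : Fin n => r + 1 ≤ w.val ∧ w.val + 1 < n
  have huv : u ≠ v := fun h => by have := congrArg Fin.val h; simp only [u, v] at this; omega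
  have hvM : v ∉ M := by simp only [M, v, Finset.mem_filter]; omega
  let e : ℝ := 1 / n
  let x : Fin n → ℝ := fun i => if i = v then e else 1
  have hn0 : (0 : ℝ) < n := by exact_mod_cast (by omega : 0 < n)
  have hq := gam_dotProduct hn huv hvM (Equiv.refl _) (fun i => by simp [u, Fin.ext_iff])
    (fun i => by simp only [v, Fin.ext_iff, Equiv.refl_apply]; omega) (fun i => by simp [M]) x
  have s1 : ∀ a : ℝ, ∑ i, (if i = v then a else 1) = (n - 1 + a : ℝ) := by
    intro a
    rw [← Finset.add_sum_erase _ _ (Finset.mem_univ v), if_pos rfl,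
      Finset.sum_congr rfl fun i hi => if_neg (Finset.ne_of_mem_erase hi)]
    simp only [Finset.sum_const, nsmul_eq_mul, mul_one,
      Finset.card_erase_of_mem (Finset.mem_univ v), Finset.card_univ, Fintype.card_fin]
    rw [Nat.cast_sub (by omega)]
    push_cast
    ring
  have hsum : ∑ i, x i = n - 1 + e := s1 e
  have hsq : ∑ i, x i ^ 2 = n - 1 + e ^ 2 := by
    rw [← s1]
    exact Finset.sum_congr rfl fun i _ => by simp only [x]; split_ifs <;> simp
  have hMs : ∑ j ∈ M, x j = n - 2 - r := by
    rw [Finset.sum_congr rfl fun i (hi : i ∈ M) => if_neg fun h : i = v => hvM (h ▸ hi)]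
    simp only [Finset.sum_const, nsmul_eq_mul, mul_one]
    rw [card_filter_gam hn, Nat.cast_sub (by omega), Nat.cast_sub (by omega)]
    norm_num
  have hxu : x u = 1 := if_neg huv
  have hxv : x v = e := if_pos rfl
  have hb := (Gam r n).dotProduct_mulVec_le_spectralRadius (x ∘ (Equiv.refl (Fin n)).symm)
  have hxx : (x ∘ (Equiv.refl (Fin n)).symm) ⬝ᵥ (x ∘ (Equiv.refl (Fin n)).symm)
      = n - 1 + e ^ 2 := by
    rw [← hsq]
    simp [dotProduct, sq]
  rw [hq, hxx, hsum, hsq, hMs, hxu, hxv] at hb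
  by_contra! hcon
  have hr' : (2 : ℝ) ≤ r := by exact_mod_cast hr
  have he : e * n = 1 := by simp only [e]; field_simp
  have he0 : 0 < e := by positivity
  have h1 : (Gam r n).spectralRadius * (n - 1 + e ^ 2) ≤ (n - 2) * (n - 1 + e ^ 2) := by
    apply mul_le_mul_of_nonneg_right hcon
    have : (1 : ℝ) ≤ n := by exact_mod_cast (by omega : 1 ≤ n)
    nlinarith [sq_nonneg e]
  nlinarith

/-- The classes `{u}`, `{v}`, `M` and the rest. -/
def color {V : Type*} [DecidableEq V] (u v : V) (M : Finset V) (i : V) : Fin 4 :=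
  if i = u then 0 else if i = v then 1 else if i ∈ M then 2 else 3

theorem card_color {V : Type*} [Fintype V] [DecidableEq V] {u v : V} (huv : u ≠ v)
    {M : Finset V} (huM : u ∉ M) (hvM : v ∉ M) (c : Fin 4) :
    Fintype.card {i // color u v M i = c} =
      ![1, 1, M.card, Fintype.card V - (M.card + 2)] c := by
  rw [Fintype.card_subtype]
  fin_cases c
  · have : (Finset.univ.filter fun i => color u v M i = 0) = {u} := by
      ext i
      rw [Finset.mem_filter]
      simp only [color, Finset.mem_univ, true_and, Finset.mem_singleton]
      split_ifs <;> simp_all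
    simp [this]
  · have : (Finset.univ.filter fun i => color u v M i = 1) = {v} := by
      ext i
      rw [Finset.mem_filter]
      simp only [color, Finset.mem_univ, true_and, Finset.mem_singleton]
      split_ifs <;> simp_all
    simp [this]
  · have : (Finset.univ.filter fun i => color u v M i = 2) = M := by
      ext i
      rw [Finset.mem_filter]
      simp only [color, Finset.mem_univ, true_and]
      split_ifs <;> simp_all
    simp [this]
  · have : (Finset.univ.filter fun i => color u v M i = 3) = (insert u (insert v M))ᶜ := by
      ext i
      rw [Finset.mem_filter]
      simp only [color, Finset.mem_univ, true_and, Finset.mem_compl,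
        Finset.mem_insert]
      split_ifs <;> simp_all
    simp only [Fin.reduceFinMk, this, Finset.card_compl]
    rw [Finset.card_insert_of_notMem (by simp [huv, huM]), Finset.card_insert_of_notMem hvM]
    simp

/-- Both vertex sets split into classes of sizes 1, 1, n-2-r and r; any bijection respecting the
classes works. -/
theorem exists_gam_labelling {V : Type*} [Fintype V] [DecidableEq V] {r n : ℕ}
    (hn : Fintype.card V = n) (hr : r + 2 ≤ n) {u v : V} (huv : u ≠ v) {M : Finset V}
    (huM : u ∉ M) (hvM : v ∉ M) (hM : M.card = n - 2 - r) :
    ∃ φ : V ≃ Fin n, (∀ i, i = u ↔ (φ i).val = 0) ∧ (∀ i, i = v ↔ (φ i).val + 1 = n) ∧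
      (∀ i, i ∈ M ↔ r + 1 ≤ (φ i).val ∧ (φ i).val + 1 < n) := by
  let u' : Fin n := ⟨0, by omega⟩
  let v' : Fin n := ⟨n - 1, by omega⟩
  let M' := Finset.univ.filter fun w : Fin n => r + 1 ≤ w.val ∧ w.val + 1 < n
  have huv' : u' ≠ v' := fun h => by
    have := congrArg Fin.val h; simp only [u', v'] at this; omega
  have huM' : u' ∉ M' := by simp [M', u']
  have hvM' : v' ∉ M' := by simp only [M', v', Finset.mem_filter]; omega
  have hcard : ∀ c, Fintype.card {i // color u v M i = c} =
      Fintype.card {i // color u' v' M' i = c} := by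
    intro c
    rw [card_color huv huM hvM, card_color huv' huM' hvM', hM, card_filter_gam hr, hn,
      Fintype.card_fin]
  let φ : V ≃ Fin n := Equiv.ofFiberEquiv fun c => Fintype.equivOfCardEq (hcard c)
  have hφ : ∀ i, color u' v' M' (φ i) = color u v M i := fun i => Equiv.ofFiberEquiv_map _ i
  refine ⟨φ, fun i => ?_, fun i => ?_, fun i => ?_⟩
  · have h := hφ i
    have e : φ i = u' ↔ (φ i).val = 0 := by simp [u', Fin.ext_iff]
    rw [← e]
    revert h
    simp only [color]
    split_ifs <;> simp_all
  · have h := hφ i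
    have e : φ i = v' ↔ (φ i).val + 1 = n := by simp only [v', Fin.ext_iff]; omega
    rw [← e]
    revert h
    simp only [color]
    split_ifs <;> simp_all
  · have h := hφ i
    have e : φ i ∈ M' ↔ r + 1 ≤ (φ i).val ∧ (φ i).val + 1 < n := by simp [M']
    rw [← e]
    revert h
    simp only [color]
    split_ifs <;> simp_all

end SignedGraph

/-! ### Comparing defects along a negative edge -/

theorem Finset.sum_univ_eq_add_add_erase {V : Type*} [Fintype V] [DecidableEq V] {u v : V}
    (huv : u ≠ v) (f : V → ℝ) :
    ∑ i, f i = f u + f v + ∑ i ∈ (Finset.univ.erase u).erase v, f i := by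
  rw [← Finset.add_sum_erase _ f (Finset.mem_univ u),
    ← Finset.add_sum_erase _ f (Finset.mem_erase.2 ⟨huv.symm, Finset.mem_univ v⟩), add_assoc]

theorem Finset.sum_univ_sum_univ_eq {V : Type*} [Fintype V] [DecidableEq V] {u v : V}
    (huv : u ≠ v) (b : V → V → ℝ) (hb : ∀ i j, b i j = b j i) :
    ∑ i, ∑ j, b i j = b u u + b v v + 2 * b u v +
      2 * ∑ w ∈ (Finset.univ.erase u).erase v, (b u w + b v w) +
      ∑ i ∈ (Finset.univ.erase u).erase v, ∑ j ∈ (Finset.univ.erase u).erase v, b i j := by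
  have h : ∀ i, ∑ j, b i j = b i u + b i v + ∑ j ∈ (Finset.univ.erase u).erase v, b i j :=
    fun i => Finset.sum_univ_eq_add_add_erase huv _
  rw [Finset.sum_univ_eq_add_add_erase huv]
  simp only [h, Finset.sum_add_distrib]
  rw [hb v u, Finset.sum_congr rfl fun i _ => hb i u, Finset.sum_congr rfl fun i _ => hb i v]
  ring

namespace SignedGraph

open Classical in
/-- If `uv` forms negative triangles with all vertices of `W`, then `W` spans at most `m` adjacent
ordered pairs. -/
def FewAdjPairs {V : Type*} (Γ : SignedGraph V) (m : ℕ) : Prop :=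
  ∀ (u v : V) (W : Finset V), Γ.graph.Adj u v → (∀ w ∈ W, Γ.graph.Adj u w) →
    (∀ w ∈ W, Γ.graph.Adj v w) →
    (∀ w ∈ W, Γ.sign s(u, v) * Γ.sign s(v, w) * Γ.sign s(w, u) = -1) →
    (W.offDiag.filter fun p => Γ.graph.Adj p.1 p.2).card ≤ m

/-- Each potential enters a triangle twice, so the sign of a triangle is switching invariant. -/
theorem FewAdjPairs.switch {V : Type*} {Γ : SignedGraph V} {m : ℕ} (h : Γ.FewAdjPairs m)
    (U : Set V) : (Γ.switch U).FewAdjPairs m := by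
  intro u v W huv hu hv hneg
  refine h u v W huv hu hv fun w hw => ?_
  rw [← hneg w hw, switch_sign, switch_sign, switch_sign]
  have e1 := Int.units_mul_self (potential U u)
  have e2 := Int.units_mul_self (potential U v)
  have e3 := Int.units_mul_self (potential U w)
  calc _ = (potential U u * potential U u) * (potential U v * potential U v) *
        (potential U w * potential U w) *
        (Γ.sign s(u, v) * Γ.sign s(v, w) * Γ.sign s(w, u)) := by
        rw [e1, e2, e3]; simp
    _ = _ := by ac_rfl

open Classical in
/-- The nonadjacent ordered pairs in `W`. -/
noncomputable def nonadjPairs {V : Type*} (Γ : SignedGraph V) (W : Finset V) : Finset (V × V) :=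
  W.offDiag.filter fun p => ¬ Γ.graph.Adj p.1 p.2

open Classical in
theorem mem_nonadjPairs {V : Type*} {Γ : SignedGraph V} {W : Finset V} {p : V × V} :
    p ∈ Γ.nonadjPairs W ↔ (p.1 ∈ W ∧ p.2 ∈ W ∧ p.1 ≠ p.2) ∧ ¬ Γ.graph.Adj p.1 p.2 := by
  rw [nonadjPairs, Finset.mem_filter, Finset.mem_offDiag]

theorem FewAdjPairs.le_nonadjPairs {V : Type*} {Γ : SignedGraph V} {m : ℕ}
    (h : Γ.FewAdjPairs m) {u v : V} {W : Finset V} (huv : Γ.graph.Adj u v)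
    (hu : ∀ w ∈ W, Γ.graph.Adj u w) (hv : ∀ w ∈ W, Γ.graph.Adj v w)
    (hneg : ∀ w ∈ W, Γ.sign s(u, v) * Γ.sign s(v, w) * Γ.sign s(w, u) = -1) :
    W.card * W.card ≤ (Γ.nonadjPairs W).card + m + W.card := by
  classical
  have h1 := h u v W huv hu hv hneg
  have h2 := Finset.card_filter_add_card_filter_not (s := W.offDiag)
    (fun p => Γ.graph.Adj p.1 p.2)
  rw [Finset.offDiag_card] at h2
  have h3 : (Γ.nonadjPairs W).card =
    (W.offDiag.filter fun p => ¬ Γ.graph.Adj p.1 p.2).card := by unfold nonadjPairs; congr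
  rw [h3]
  have h4 : (W.offDiag.filter fun p => Γ.graph.Adj p.1 p.2).card ≤ m := by convert h1
  generalize W.card * W.card = z at *
  omega

/-- Nonadjacent pairs within `W` contribute fully to the defect, for either sign of the matrix. -/
theorem sum_nonadjPairs_le {V : Type*} [Fintype V] [DecidableEq V] {Γ : SignedGraph V}
    {A : Matrix V V ℝ} {y : V → ℝ} {lam : ℝ} (h : NearComplete A y lam)
    (hA : ∀ i j, ¬ Γ.graph.Adj i j → A i j = 0) (W : Finset V) :
    ∑ p ∈ Γ.nonadjPairs W, y p.1 * y p.2 ≤ ∑ i ∈ W, ∑ j ∈ W, defect A i j * y i * y j := by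
  rw [← Finset.sum_product']
  calc ∑ p ∈ Γ.nonadjPairs W, y p.1 * y p.2
      = ∑ p ∈ Γ.nonadjPairs W, defect A p.1 p.2 * y p.1 * y p.2 := by
        refine Finset.sum_congr rfl fun p hp => ?_
        obtain ⟨⟨-, -, h1⟩, h2⟩ := mem_nonadjPairs.1 hp
        rw [defect, if_neg h1, hA _ _ h2]
        ring
    _ ≤ _ := by
        refine Finset.sum_le_sum_of_subset_of_nonneg (fun p hp => ?_)
          fun p _ _ => h.term_nonneg p.1 p.2
        obtain ⟨⟨h1, h2, -⟩, -⟩ := mem_nonadjPairs.1 hp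
        exact Finset.mem_product.2 ⟨h1, h2⟩

/-- Nonadjacent pairs outweigh the `k` extra vertices of `W`. -/
theorem exists_subset_gain {V : Type*} [Fintype V] [DecidableEq V] {Γ : SignedGraph V}
    {A : Matrix V V ℝ} {y : V → ℝ} {lam : ℝ} (h : NearComplete A y lam) {W : Finset V} {r k : ℕ}
    (hk : 1 ≤ k) (hW : W.card = r + k)
    (hcount : ∀ W' ⊆ W, ∀ l, W'.card = r + l → 4 * l ≤ (Γ.nonadjPairs W').card) (v : V) :
    ∃ K ⊆ W, K.card = k ∧ 2 * y v * ∑ w ∈ K, y w < ∑ p ∈ Γ.nonadjPairs W, y p.1 * y p.2 := by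
  have : Nonempty V := ⟨v⟩
  obtain ⟨w, hw⟩ := Finite.exists_min y
  have hkR : (1 : ℝ) ≤ k := by exact_mod_cast hk
  have hyv := h.le_of_large v
  have hyv0 := h.nonneg v
  -- Pairs avoiding the minimum w weigh at least 0.6, so 4k of them beat 2·1.001²·k. If w lies in W,
  -- pairs through w may be light; putting w into K lightens the other side as well.
  by_cases hwW : w ∈ W
  · obtain ⟨K, hwK, hKW, hKc⟩ := Finset.exists_subsuperset_card_eq
      (Finset.singleton_subset_iff.2 hwW) (n := k) (by simpa using hk) (by omega)
    rw [Finset.singleton_subset_iff] at hwK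
    refine ⟨K, hKW, hKc, ?_⟩
    have hKsum : ∑ i ∈ K, y i ≤ y w + (k - 1) * 1.001 := by
      rw [← Finset.add_sum_erase _ _ hwK]
      have h1 := Finset.sum_le_card_nsmul (K.erase w) y 1.001 fun i _ => h.le_of_large i
      rw [Finset.card_erase_of_mem hwK, hKc, nsmul_eq_mul, Nat.cast_sub hk] at h1
      push_cast at h1
      linarith
    have hsub : Γ.nonadjPairs (W.erase w) ⊆ Γ.nonadjPairs W := fun p hp => by
      obtain ⟨⟨h1, h2, h3⟩, h4⟩ := mem_nonadjPairs.1 hp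
      exact mem_nonadjPairs.2
        ⟨⟨Finset.mem_of_mem_erase h1, Finset.mem_of_mem_erase h2, h3⟩, h4⟩
    have c1 : (4 : ℝ) * k ≤ (Γ.nonadjPairs W).card := by
      exact_mod_cast hcount W subset_rfl k hW
    have c2 : (4 : ℝ) * (k - 1) ≤ (Γ.nonadjPairs (W.erase w)).card := by
      have := hcount (W.erase w) (Finset.erase_subset _ _) (k - 1)
        (by rw [Finset.card_erase_of_mem hwW]; omega)
      have h2 : ((4 * (k - 1) : ℕ) : ℝ) ≤ (Γ.nonadjPairs (W.erase w)).card := by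
        exact_mod_cast this
      rw [Nat.cast_mul, Nat.cast_sub hk] at h2
      exact_mod_cast h2
    have s1 : (Γ.nonadjPairs (W.erase w)).card • (0.6 : ℝ) ≤
        ∑ p ∈ Γ.nonadjPairs (W.erase w), y p.1 * y p.2 :=
      Finset.card_nsmul_le_sum _ _ _ fun p hp => by
        obtain ⟨⟨h1, h2, h3⟩, -⟩ := mem_nonadjPairs.1 hp
        exact h.mul_ge_of_ne_min hw (Finset.ne_of_mem_erase h1) (Finset.ne_of_mem_erase h2) h3
    have s2 : (Γ.nonadjPairs W \ Γ.nonadjPairs (W.erase w)).card • (0.7 * y w) ≤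
        ∑ p ∈ Γ.nonadjPairs W \ Γ.nonadjPairs (W.erase w), y p.1 * y p.2 :=
      Finset.card_nsmul_le_sum _ _ _ fun p hp => by
        obtain ⟨hp1, hp2⟩ := Finset.mem_sdiff.1 hp
        obtain ⟨⟨h1, h2, h3⟩, h4⟩ := mem_nonadjPairs.1 hp1
        by_cases e1 : p.1 = w
        · have := h.ge_of_ne_min hw (a := p.2) (fun e2 => h3 (e1.trans e2.symm))
          rw [e1]
          nlinarith [h.nonneg w]
        · have a1 := h.ge_of_ne_min hw e1
          have a2 := hw p.2
          nlinarith [h.nonneg w]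
    have s3 := Finset.sum_sdiff (f := fun p : V × V => y p.1 * y p.2) hsub
    rw [Finset.card_sdiff_of_subset hsub, nsmul_eq_mul,
      Nat.cast_sub (Finset.card_le_card hsub)] at s2
    rw [nsmul_eq_mul] at s1
    have hw0 := h.pos w
    have hw1 := h.le_of_large w
    have s4 : (Finset.card (Γ.nonadjPairs W \ Γ.nonadjPairs (W.erase w)) : ℝ) =
        (Γ.nonadjPairs W).card - (Γ.nonadjPairs (W.erase w)).card := by
      rw [Finset.card_sdiff_of_subset hsub, Nat.cast_sub (Finset.card_le_card hsub)]
    have s5 : (0 : ℝ) ≤ (Γ.nonadjPairs W).card - (Γ.nonadjPairs (W.erase w)).card := by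
      rw [← s4]; positivity
    rw [← s3]
    generalize ((Γ.nonadjPairs W).card : ℝ) = N at *
    generalize ((Γ.nonadjPairs (W.erase w)).card : ℝ) = N' at *
    have t1 : 2 * y v * ∑ i ∈ K, y i ≤ 2 * 1.001 * (y w + (k - 1) * 1.001) := by
      have : 0 ≤ ∑ i ∈ K, y i := Finset.sum_nonneg fun i _ => h.nonneg i
      exact mul_le_mul (by linarith) hKsum this (by norm_num)
    -- As 0.59·y_w ≤ 0.6, pairs of `W.erase w` beyond 4(k-1) may be revalued at 0.59·y_w. This
    -- leaves at least 2.4(k-1) + 2.36·y_w, and y_w > 0 makes the gain strict.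
    have t2 : 0.59 * y w * (N - N') ≤ (N - N') * (0.7 * y w) := by nlinarith
    have t3 : 0.59 * y w * (N' - 4 * (k - 1)) ≤ 0.6 * (N' - 4 * (k - 1)) :=
      mul_le_mul_of_nonneg_right (by linarith) (by linarith)
    have t4 : 0.59 * y w * 4 ≤ 0.59 * y w * (N - 4 * (k - 1)) :=
      mul_le_mul_of_nonneg_left (by linarith) (by linarith)
    nlinarith
  · obtain ⟨K, hKW, hKc⟩ := Finset.exists_subset_card_eq (n := k) (s := W) (by omega)
    refine ⟨K, hKW, hKc, ?_⟩
    have hKsum := Finset.sum_le_card_nsmul K y 1.001 fun i _ => h.le_of_large i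
    have s1 : (Γ.nonadjPairs W).card • (0.6 : ℝ) ≤ ∑ p ∈ Γ.nonadjPairs W, y p.1 * y p.2 :=
      Finset.card_nsmul_le_sum _ _ _ fun p hp => by
        obtain ⟨⟨h1, h2, h3⟩, -⟩ := mem_nonadjPairs.1 hp
        exact h.mul_ge_of_ne_min hw (fun e => hwW (e ▸ h1)) (fun e => hwW (e ▸ h2)) h3
    have c1 : (4 : ℝ) * k ≤ (Γ.nonadjPairs W).card := by
      exact_mod_cast hcount W subset_rfl k hW
    rw [nsmul_eq_mul] at s1 hKsum
    rw [hKc] at hKsum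
    have t1 : 2 * y v * ∑ i ∈ K, y i ≤ 2 * 1.001 * (k * 1.001) := by
      have : 0 ≤ ∑ i ∈ K, y i := Finset.sum_nonneg fun i _ => h.nonneg i
      exact mul_le_mul (by linarith) hKsum this (by norm_num)
    linarith

/-- The comparison of the defect of `Γ` with that of a copy of `Γ_{r,n}`. -/
theorem exists_missing_set {V : Type*} [Fintype V] [DecidableEq V] {Γ : SignedGraph V}
    {y : V → ℝ} {lam : ℝ} (h : NearComplete Γ.adjMatrix y lam) {r : ℕ} (hr : 2 ≤ r)
    (hrn : r + 2 ≤ Fintype.card V) (hfew : Γ.FewAdjPairs (r * (r - 1))) {u v : V}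
    (huv : Γ.adjMatrix u v = -1) (hyuv : y v ≤ y u) :
    ∃ M ⊆ (Finset.univ.erase u).erase v, M.card = Fintype.card V - 2 - r ∧
      (4 * y u * y v + 2 * y v * ∑ j ∈ M, y j <
          ∑ i, ∑ j, defect Γ.adjMatrix i j * y i * y j ∨
        (∀ w ∈ M, ¬ (Γ.adjMatrix u w = 1 ∧ Γ.adjMatrix v w = 1)) ∧
        4 * y u * y v + 2 * y v * ∑ j ∈ M, y j ≤
          ∑ i, ∑ j, defect Γ.adjMatrix i j * y i * y j) := by
  classical
  have hne : u ≠ v := by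
    rintro rfl
    rw [adjMatrix_self] at huv
    norm_num at huv
  set O := (Finset.univ.erase u).erase v with hO
  have hOu : ∀ w ∈ O, w ≠ u := fun w hw => Finset.ne_of_mem_erase (Finset.mem_of_mem_erase hw)
  have hOv : ∀ w ∈ O, w ≠ v := fun w hw => Finset.ne_of_mem_erase hw
  have hOcard : O.card = Fintype.card V - 2 := by
    rw [hO, Finset.card_erase_of_mem (Finset.mem_erase.2 ⟨hne.symm, Finset.mem_univ v⟩),
      Finset.card_erase_of_mem (Finset.mem_univ u), Finset.card_univ]
    omega
  set W := O.filter fun w => Γ.adjMatrix u w = 1 ∧ Γ.adjMatrix v w = 1 with hWdef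
  set M₀ := O.filter fun w => ¬ (Γ.adjMatrix u w = 1 ∧ Γ.adjMatrix v w = 1) with hM₀def
  have hcards : W.card + M₀.card = Fintype.card V - 2 := by
    rw [← hOcard]
    exact Finset.card_filter_add_card_filter_not _
  have hWO : W ⊆ O := Finset.filter_subset _ _
  have hM₀O : M₀ ⊆ O := Finset.filter_subset _ _
  have hd : ∀ i j, i ≠ j → defect Γ.adjMatrix i j = 1 - Γ.adjMatrix i j :=
    fun i j hij => if_neg hij
  -- A vertex of M₀ has defect at least 1 towards u or v; as y_v ≤ y_u, either costs at least y_v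
  -- y_w.
  have hQ : 4 * y u * y v + 2 * y v * ∑ w ∈ M₀, y w +
      ∑ i ∈ W, ∑ j ∈ W, defect Γ.adjMatrix i j * y i * y j ≤
      ∑ i, ∑ j, defect Γ.adjMatrix i j * y i * y j := by
    rw [Finset.sum_univ_sum_univ_eq hne _ fun i j => by rw [h.defect_comm]; ring]
    have e1 : defect Γ.adjMatrix u v = 2 := by rw [hd _ _ hne, huv]; norm_num
    have e2 : ∀ i, defect Γ.adjMatrix i i = 0 := fun i => if_pos rfl
    have e3 : ∑ i ∈ W, ∑ j ∈ W, defect Γ.adjMatrix i j * y i * y j ≤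
        ∑ i ∈ O, ∑ j ∈ O, defect Γ.adjMatrix i j * y i * y j :=
      (Finset.sum_le_sum fun i _ => Finset.sum_le_sum_of_subset_of_nonneg hWO
        fun j _ _ => h.term_nonneg i j).trans
      (Finset.sum_le_sum_of_subset_of_nonneg hWO
        fun i _ _ => Finset.sum_nonneg fun j _ => h.term_nonneg i j)
    have e4 : y v * ∑ w ∈ M₀, y w ≤ ∑ w ∈ O,
        (defect Γ.adjMatrix u w * y u * y w + defect Γ.adjMatrix v w * y v * y w) := by
      rw [Finset.mul_sum]
      refine (Finset.sum_le_sum fun w hw => ?_).trans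
        (Finset.sum_le_sum_of_subset_of_nonneg hM₀O fun w _ _ =>
          add_nonneg (h.term_nonneg u w) (h.term_nonneg v w))
      obtain ⟨hwO, hw1⟩ := Finset.mem_filter.1 hw
      have a1 := h.nonneg w
      have a2 := h.nonneg v
      have a3 : y v * y w ≤ y u * y w := mul_le_mul_of_nonneg_right hyuv a1
      have a4 := mul_nonneg a2 a1
      have b1 := h.defect_nonneg u w
      have b2 := h.defect_nonneg v w
      have b3 : 1 ≤ defect Γ.adjMatrix u w ∨ 1 ≤ defect Γ.adjMatrix v w := by
        rw [hd _ _ (hOu w hwO).symm, hd _ _ (hOv w hwO).symm]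
        rcases Γ.adjMatrix_trichotomy u w with ⟨-, e⟩ | ⟨-, -, e⟩ | ⟨-, -, e⟩
        · left; rw [e]; norm_num
        · rcases Γ.adjMatrix_trichotomy v w with ⟨-, e'⟩ | ⟨-, -, e'⟩ | ⟨-, -, e'⟩
          · right; rw [e']; norm_num
          · exact absurd ⟨e, e'⟩ hw1
          · right; rw [e']; norm_num
        · left; rw [e]; norm_num
      rcases b3 with b3 | b3 <;> nlinarith [mul_nonneg b1 (a4.trans a3), mul_nonneg b2 a4]
    rw [e1, e2, e2]
    linarith
  have hgain0 : 0 ≤ ∑ i ∈ W, ∑ j ∈ W, defect Γ.adjMatrix i j * y i * y j :=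
    Finset.sum_nonneg fun i _ => Finset.sum_nonneg fun j _ => h.term_nonneg i j
  rcases le_or_gt W.card r with hWr | hWr
  · obtain ⟨M, hMsub, hMc⟩ := Finset.exists_subset_card_eq
      (n := Fintype.card V - 2 - r) (s := M₀) (by omega)
    refine ⟨M, hMsub.trans hM₀O, hMc, .inr ⟨fun w hw => (Finset.mem_filter.1 (hMsub hw)).2, ?_⟩⟩
    have e1 : ∑ w ∈ M, y w ≤ ∑ w ∈ M₀, y w :=
      Finset.sum_le_sum_of_subset_of_nonneg hMsub fun i _ _ => h.nonneg i
    nlinarith [h.nonneg v]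
  · obtain ⟨k, hk⟩ : ∃ k, W.card = r + k := ⟨W.card - r, by omega⟩
    have huvA : Γ.graph.Adj u v ∧ Γ.sign s(u, v) = -1 := by
      rcases Γ.adjMatrix_trichotomy u v with ⟨-, e⟩ | ⟨-, -, e⟩ | ⟨e1, e2, -⟩
      · rw [e] at huv; norm_num at huv
      · rw [e] at huv; norm_num at huv
      · exact ⟨e1, e2⟩
    have hone : ∀ a b, Γ.adjMatrix a b = 1 → Γ.graph.Adj a b ∧ Γ.sign s(a, b) = 1 := by
      intro a b hab
      rcases Γ.adjMatrix_trichotomy a b with ⟨-, e⟩ | ⟨e1, e2, -⟩ | ⟨-, -, e⟩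
      · rw [e] at hab; norm_num at hab
      · exact ⟨e1, e2⟩
      · rw [e] at hab; norm_num at hab
    have hcount : ∀ W' ⊆ W, ∀ l, W'.card = r + l → 4 * l ≤ (Γ.nonadjPairs W').card := by
      intro W' hW' l hl
      have hmem : ∀ w ∈ W', Γ.adjMatrix u w = 1 ∧ Γ.adjMatrix v w = 1 := fun w hw =>
        (Finset.mem_filter.1 (hW' hw)).2
      have hc := hfew.le_nonadjPairs (W := W') huvA.1 (fun w hw => (hone _ _ (hmem w hw).1).1)
        (fun w hw => (hone _ _ (hmem w hw).2).1) (fun w hw => by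
          rw [huvA.2, (hone _ _ (hmem w hw).2).2, Sym2.eq_swap, (hone _ _ (hmem w hw).1).2]
          norm_num)
      rw [hl] at hc
      -- The count is (r+l)(r+l-1) - r(r-1) = 2rl + l² - l, at least 4l because r ≥ 2.
      obtain ⟨r', rfl⟩ : ∃ r', r = r' + 2 := ⟨r - 2, by omega⟩
      have e : r' + 2 - 1 = r' + 1 := by omega
      rw [e] at hc
      nlinarith [Nat.le_mul_self l, Nat.zero_le (r' * l)]
    obtain ⟨K, hKW, hKc, hK⟩ := exists_subset_gain h (by omega) hk hcount v
    have hdisj : Disjoint M₀ K := by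
      rw [Finset.disjoint_left]
      intro w h1 h2
      exact (Finset.mem_filter.1 h1).2 (Finset.mem_filter.1 (hKW h2)).2
    refine ⟨M₀ ∪ K, Finset.union_subset hM₀O (hKW.trans hWO), ?_, .inl ?_⟩
    · rw [Finset.card_union_of_disjoint hdisj]
      omega
    · rw [Finset.sum_union hdisj]
      have := sum_nonadjPairs_le h (fun i j hij => adjMatrix_eq_of_not_adj hij) W
      linarith

end SignedGraph

/-! ### Rigidity when the spectral radius is the largest eigenvalue -/

namespace SignedGraph

/-- A nearly complete signed graph with a negative edge and few unbalanced `K₄` whose index is at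
least that of `Γ_{r,n}` is `Γ_{r,n}` up to relabelling. -/
theorem isomorphic_gam_of_le {n r : ℕ} {Γ : SignedGraph (Fin n)} {y : Fin n → ℝ} {lam : ℝ}
    (h : NearComplete Γ.adjMatrix y lam) (hr : 2 ≤ r) (hrn : r + 2 ≤ n)
    (hfew : Γ.FewAdjPairs (r * (r - 1))) {a b : Fin n} (hab : Γ.adjMatrix a b = -1)
    (hle : (Gam r n).spectralRadius ≤ lam) : Γ.Isomorphic (Gam r n) := by
  obtain ⟨u, v, huv, hyuv⟩ : ∃ u v, Γ.adjMatrix u v = -1 ∧ y v ≤ y u := by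
    rcases le_total (y b) (y a) with h1 | h1
    · exact ⟨a, b, hab, h1⟩
    · exact ⟨b, a, by rw [adjMatrix_comm, hab], h1⟩
  have hne : u ≠ v := by
    rintro rfl
    rw [adjMatrix_self] at huv
    norm_num at huv
  obtain ⟨M, hMO, hMc, hM⟩ :=
    exists_missing_set h hr (by rwa [Fintype.card_fin]) hfew huv hyuv
  rw [Fintype.card_fin] at hMc
  have huM : u ∉ M := fun hu => Finset.ne_of_mem_erase (Finset.mem_of_mem_erase (hMO hu)) rfl
  have hvM : v ∉ M := fun hv => Finset.ne_of_mem_erase (hMO hv) rfl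
  obtain ⟨φ, hu, hv, hφM⟩ := exists_gam_labelling (Fintype.card_fin n) hrn hne huM hvM hMc
  set z := y ∘ φ.symm with hz
  have hq := gam_dotProduct hrn hne hvM φ hu hv hφM y
  rw [← hz, h.norm] at hq
  have hzz : z ⬝ᵥ z = n := by
    have := h.norm
    rw [Fintype.card_fin] at this
    rw [← this, dotProduct, ← φ.sum_comp]
    exact Finset.sum_congr rfl fun i _ => by simp [hz, sq]
  have hb := (Gam r n).dotProduct_mulVec_le_spectralRadius z
  have htot := h.total_defect
  have hn0 : (0 : ℝ) < n := by
    have := h.large_real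
    rw [Fintype.card_fin] at this
    linarith
  rw [hzz] at hb
  rw [Fintype.card_fin] at hq htot
  have hle' : (Gam r n).spectralRadius * n ≤ lam * n := mul_le_mul_of_nonneg_right hle hn0.le
  -- A strictly smaller defect would give the copy a Rayleigh quotient above `lam`. Otherwise
  -- equality holds throughout and `z` is an eigenvector of the copy.
  rcases hM with hM | ⟨hM, hMle⟩
  · linarith
  have hlam : lam = (Gam r n).spectralRadius := by
    have : lam * n ≤ (Gam r n).spectralRadius * n := by linarith
    exact le_antisymm (le_of_mul_le_mul_right this hn0) hle
  have heig := (Gam r n).mulVec_eq_of_dotProduct_eq (x := z) (by rw [hzz]; linarith)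
  have hd : ∀ i j, i ≠ j → defect Γ.adjMatrix i j = 1 - Γ.adjMatrix i j :=
    fun i j hij => if_neg hij
  -- y is an eigenvector of both matrices for the same eigenvalue.
  have hrow : ∀ i, ∑ j, gamDefect u v M i j * y j = ∑ j, defect Γ.adjMatrix i j * y j := by
    intro i
    have e1 := congrFun heig (φ i)
    rw [mulVec, dotProduct, ← φ.sum_comp, Pi.smul_apply, smul_eq_mul, ← hlam] at e1
    simp only [hz, Function.comp, φ.symm_apply_apply] at e1
    rw [h.sum_defect]
    have e2 : ∀ j, (Gam r n).adjMatrix (φ i) (φ j) * y j =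
        y j - gamDefect u v M i j * y j - if i = j then y j else 0 := by
      intro j
      by_cases hij : i = j
      · subst hij
        have h0 := gamDefect_self hne hvM i
        rw [adjMatrix_self, h0, if_pos rfl]
        ring
      · rw [gam_adjMatrix hrn φ hu hv hφM hij, if_neg hij]
        ring
    simp only [e2, Finset.sum_sub_distrib, Finset.sum_ite_eq, Finset.mem_univ, if_true] at e1
    linarith
  have hduv : defect Γ.adjMatrix u v = 2 := by rw [hd _ _ hne, huv]; norm_num
  -- In row u the entry at v alone exhausts the weighted sum 2y_v.
  have hdu : ∀ j, j ≠ v → defect Γ.adjMatrix u j = 0 := by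
    have e1 := hrow u
    rw [sum_gamDefect, if_pos rfl, if_neg hne, if_neg hne, if_neg huM,
      ← Finset.add_sum_erase _ _ (Finset.mem_univ v), hduv] at e1
    have e2 : ∑ j ∈ Finset.univ.erase v, defect Γ.adjMatrix u j * y j = 0 := by linarith
    rw [Finset.sum_eq_zero_iff_of_nonneg fun j _ =>
      mul_nonneg (h.defect_nonneg u j) (h.nonneg j)] at e2
    intro j hj
    exact (mul_eq_zero.1 (e2 j (Finset.mem_erase.2 ⟨hj, Finset.mem_univ j⟩))).resolve_right
      (h.pos j).ne'
  -- Now u is positively joined to every w in M, so w must fail at v. This yields domination `hge`,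
  -- and equal row sums with positive weights force equality.
  have hdv : ∀ w ∈ M, 1 ≤ defect Γ.adjMatrix v w := by
    intro w hw
    have hwu : u ≠ w := fun e => huM (e ▸ hw)
    have hwv : v ≠ w := fun e => hvM (e ▸ hw)
    have e1 := hdu w hwv.symm
    rw [hd _ _ hwu] at e1
    have e2 : Γ.adjMatrix u w = 1 := by linarith
    rw [hd _ _ hwv]
    rcases Γ.adjMatrix_trichotomy v w with ⟨-, e⟩ | ⟨-, -, e⟩ | ⟨-, -, e⟩
    · rw [e]; norm_num
    · exact absurd ⟨e2, e⟩ (hM w hw)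
    · rw [e]; norm_num
  have hge : ∀ i j, gamDefect u v M i j ≤ defect Γ.adjMatrix i j := by
    intro i j
    have h0 := h.defect_nonneg i j
    by_cases c1 : i = u ∧ j = v
    · obtain ⟨rfl, rfl⟩ := c1
      simp [gamDefect, hne, hne.symm, huM, hvM, hduv]
    by_cases c2 : i = v ∧ j = u
    · obtain ⟨rfl, rfl⟩ := c2
      rw [h.defect_comm]
      simp [gamDefect, hne, hne.symm, huM, hvM, hduv]
    by_cases c3 : i = v ∧ j ∈ M
    · have c4 : ¬ (i ∈ M ∧ j = v) := fun c => hvM (c3.1 ▸ c.1)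
      rw [gamDefect, if_neg c1, if_neg c2, if_pos c3, if_neg c4, c3.1]
      linarith [hdv j c3.2]
    by_cases c4 : i ∈ M ∧ j = v
    · rw [gamDefect, if_neg c1, if_neg c2, if_neg c3, if_pos c4, c4.2, h.defect_comm]
      linarith [hdv i c4.1]
    rw [gamDefect, if_neg c1, if_neg c2, if_neg c3, if_neg c4]
    linarith
  have heq : ∀ i j, gamDefect u v M i j = defect Γ.adjMatrix i j := by
    intro i j
    have e1 := (Finset.sum_eq_sum_iff_of_le fun j _ =>
      mul_le_mul_of_nonneg_right (hge i j) (h.nonneg j)).1 (hrow i) j (Finset.mem_univ j)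
    exact mul_right_cancel₀ (h.pos j).ne' e1
  refine isomorphic_of_adjMatrix φ fun i j => ?_
  by_cases hij : i = j
  · rw [hij, adjMatrix_self, adjMatrix_self]
  · rw [gam_adjMatrix hrn φ hu hv hφM hij, heq, hd _ _ hij]
    ring

/-! ### Excluding the negative end of the spectrum -/

theorem exists_few_defects {V : Type*} [Fintype V] [DecidableEq V] {A : Matrix V V ℝ}
    {y : V → ℝ} {lam : ℝ} (h : NearComplete A y lam)
    (hA : ∀ i j, i ≠ j → A i j ≠ 1 → 1 ≤ defect A i j) {w : V} (hw : ∀ i, y w ≤ y i)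
    (T : Finset V) (hT : Fintype.card V ≤ T.card + 10) (hwT : w ∉ T) :
    ∃ u ∈ T, (T.filter fun j => j ≠ u ∧ A u j ≠ 1).card ≤ 2 := by
  have hn := h.large_real
  have hTn : (Fintype.card V : ℝ) ≤ T.card + 10 := by exact_mod_cast hT
  by_contra! hcon
  -- Three defects per vertex inside T give each row at least 3·0.49 > 1.4, and n-10 such rows
  -- exceed the total bound n.
  have h1 : ∀ u ∈ T, (1.4 : ℝ) ≤ ∑ j, defect A u j * y u * y j := by
    intro u hu
    have hyu := h.ge_of_ne_min hw (a := u) (fun e => hwT (e ▸ hu))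
    have hc := hcon u hu
    have hc' : (3 : ℝ) ≤ (T.filter fun j => j ≠ u ∧ A u j ≠ 1).card := by exact_mod_cast hc
    have h2 : (T.filter fun j => j ≠ u ∧ A u j ≠ 1).card • (0.49 : ℝ) ≤
        ∑ j ∈ T.filter fun j => j ≠ u ∧ A u j ≠ 1, defect A u j * y u * y j :=
      Finset.card_nsmul_le_sum _ _ _ fun j hj => by
        obtain ⟨hjT, hju, hj1⟩ := Finset.mem_filter.1 hj
        have hyj := h.ge_of_ne_min hw (a := j) (fun e => hwT (e ▸ hjT))
        have := hA u j hju.symm hj1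
        have h3 : (0.7 : ℝ) * 0.7 ≤ y u * y j := mul_le_mul hyu hyj (by norm_num) (by linarith)
        have h4 : 1 * (y u * y j) ≤ defect A u j * (y u * y j) :=
          mul_le_mul_of_nonneg_right this (by linarith)
        linarith
    have h3 := Finset.sum_le_sum_of_subset_of_nonneg
      (Finset.subset_univ (T.filter fun j => j ≠ u ∧ A u j ≠ 1))
      fun j _ _ => h.term_nonneg u j
    rw [nsmul_eq_mul] at h2
    linarith
  have h2 := Finset.card_nsmul_le_sum T _ _ h1
  have h3 : ∑ i ∈ T, ∑ j, defect A i j * y i * y j ≤ ∑ i, ∑ j, defect A i j * y i * y j :=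
    Finset.sum_le_sum_of_subset_of_nonneg (Finset.subset_univ T)
      fun i _ _ => Finset.sum_nonneg fun j _ => h.term_nonneg i j
  have h4 := h.total_defect_lt
  rw [nsmul_eq_mul] at h2
  linarith

/-- The negative of a signed graph with few unbalanced `K₄` is never nearly complete. -/
theorem not_nearComplete_neg {V : Type*} [Fintype V] [DecidableEq V] {Γ : SignedGraph V}
    {y : V → ℝ} {lam : ℝ} {r : ℕ} (hrn : 2 * r ≤ Fintype.card V)
    (hfew : Γ.FewAdjPairs (r * (r - 1))) : ¬ NearComplete (-Γ.adjMatrix) y lam := by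
  intro h
  have hlarge := h.large
  have : Nonempty V := Fintype.card_pos_iff.1 (by omega)
  obtain ⟨w, hw⟩ := Finite.exists_min y
  have hA : ∀ i j, i ≠ j → (-Γ.adjMatrix) i j ≠ 1 → 1 ≤ defect (-Γ.adjMatrix) i j := by
    intro i j hij h1
    rw [defect, if_neg hij]
    rw [neg_apply] at h1 ⊢
    rcases Γ.adjMatrix_trichotomy i j with ⟨-, e⟩ | ⟨-, -, e⟩ | ⟨-, -, e⟩
    · rw [e]; norm_num
    · rw [e]; norm_num
    · rw [e] at h1; norm_num at h1
  have hneg : ∀ a b, (-Γ.adjMatrix) a b = 1 → Γ.graph.Adj a b ∧ Γ.sign s(a, b) = -1 := by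
    intro a b hab
    rw [neg_apply] at hab
    rcases Γ.adjMatrix_trichotomy a b with ⟨-, e⟩ | ⟨-, -, e⟩ | ⟨e1, e2, -⟩
    · rw [e] at hab; norm_num at hab
    · rw [e] at hab; norm_num at hab
    · exact ⟨e1, e2⟩
  set T := Finset.univ.erase w with hT
  have hTc : T.card = Fintype.card V - 1 := by
    rw [hT, Finset.card_erase_of_mem (Finset.mem_univ w), Finset.card_univ]
  have hwT : w ∉ T := Finset.notMem_erase _ _
  obtain ⟨u, huT, hu⟩ := exists_few_defects h hA hw T (by omega) hwT
  have hT' : T.card ≤ (T.filter fun j => j ≠ u ∧ (-Γ.adjMatrix) u j = 1).card + 3 := by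
    have hsub : T ⊆ (T.filter fun j => j ≠ u ∧ (-Γ.adjMatrix) u j = 1) ∪
        ((T.filter fun j => j ≠ u ∧ (-Γ.adjMatrix) u j ≠ 1) ∪ {u}) := by
      intro j hj
      simp only [Finset.mem_union, Finset.mem_filter, Finset.mem_singleton]
      tauto
    have e1 := Finset.card_le_card hsub
    have e2 := Finset.card_union_le (T.filter fun j => j ≠ u ∧ (-Γ.adjMatrix) u j = 1)
      ((T.filter fun j => j ≠ u ∧ (-Γ.adjMatrix) u j ≠ 1) ∪ {u})
    have e3 := Finset.card_union_le (T.filter fun j => j ≠ u ∧ (-Γ.adjMatrix) u j ≠ 1) {u}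
    rw [Finset.card_singleton] at e3
    omega
  set T' := T.filter fun j => j ≠ u ∧ (-Γ.adjMatrix) u j = 1 with hT'def
  have hT'T : T' ⊆ T := Finset.filter_subset _ _
  obtain ⟨v, hvT, hv⟩ := exists_few_defects h hA hw T' (by omega) fun hh => hwT (hT'T hh)
  set W := T'.filter fun j => j ≠ v ∧ (-Γ.adjMatrix) v j = 1 with hWdef
  have hWc : T'.card ≤ W.card + 3 := by
    have hsub : T' ⊆ W ∪ ((T'.filter fun j => j ≠ v ∧ (-Γ.adjMatrix) v j ≠ 1) ∪ {v}) := by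
      intro j hj
      simp only [hWdef, Finset.mem_union, Finset.mem_filter, Finset.mem_singleton]
      tauto
    have e1 := Finset.card_le_card hsub
    have e2 := Finset.card_union_le W
      ((T'.filter fun j => j ≠ v ∧ (-Γ.adjMatrix) v j ≠ 1) ∪ {v})
    have e3 := Finset.card_union_le (T'.filter fun j => j ≠ v ∧ (-Γ.adjMatrix) v j ≠ 1) {v}
    rw [Finset.card_singleton] at e3
    omega
  have huv := hneg u v (Finset.mem_filter.1 hvT).2.2
  have huW : ∀ x ∈ W, Γ.graph.Adj u x ∧ Γ.sign s(u, x) = -1 := fun x hx =>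
    hneg u x (Finset.mem_filter.1 (Finset.mem_filter.1 hx).1).2.2
  have hvW : ∀ x ∈ W, Γ.graph.Adj v x ∧ Γ.sign s(v, x) = -1 := fun x hx =>
    hneg v x (Finset.mem_filter.1 hx).2.2
  have hc := hfew.le_nonadjPairs (W := W) huv.1 (fun x hx => (huW x hx).1)
    (fun x hx => (hvW x hx).1) (fun x hx => by
      rw [huv.2, (hvW x hx).2, Sym2.eq_swap, (huW x hx).2]; norm_num)
  have hwW : ∀ x ∈ W, x ≠ w := fun x hx e =>
    hwT (e ▸ hT'T (Finset.mem_filter.1 hx).1)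
  have s1 : (Γ.nonadjPairs W).card • (0.6 : ℝ) ≤ ∑ p ∈ Γ.nonadjPairs W, y p.1 * y p.2 :=
    Finset.card_nsmul_le_sum _ _ _ fun p hp => by
      obtain ⟨⟨h1, h2, h3⟩, -⟩ := mem_nonadjPairs.1 hp
      exact h.mul_ge_of_ne_min hw (hwW _ h1) (hwW _ h2) h3
  have s2 := sum_nonadjPairs_le (Γ := Γ) h
    (fun i j hij => by rw [neg_apply, adjMatrix_eq_of_not_adj hij, neg_zero]) W
  have s3 : ∑ i ∈ W, ∑ j ∈ W, defect (-Γ.adjMatrix) i j * y i * y j ≤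
      ∑ i, ∑ j, defect (-Γ.adjMatrix) i j * y i * y j :=
    (Finset.sum_le_sum fun i _ => Finset.sum_le_sum_of_subset_of_nonneg (Finset.subset_univ _)
      fun j _ _ => h.term_nonneg i j).trans
    (Finset.sum_le_sum_of_subset_of_nonneg (Finset.subset_univ _)
      fun i _ _ => Finset.sum_nonneg fun j _ => h.term_nonneg i j)
  have s4 := h.total_defect_lt
  rw [nsmul_eq_mul] at s1
  have s5 : ((Γ.nonadjPairs W).card : ℝ) < 2 * Fintype.card V := by
    have := h.large_real
    linarith
  have s6 : (Γ.nonadjPairs W).card < 2 * Fintype.card V := by exact_mod_cast s5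
  -- T omits one vertex; T' and W each lose at most three more, two defects and the chosen vertex.
  -- Then |W|² ≤ 2n + r² + |W| contradicts r ≤ n/2.
  have s7 : Fintype.card V ≤ W.card + 7 := by omega
  have s8 : r * (r - 1) ≤ r * r := Nat.mul_le_mul_left _ (Nat.sub_le _ _)
  have s9 : W.card ≤ Fintype.card V := Finset.card_le_univ W
  nlinarith

/-! ### From an extremal eigenvector to switching equivalence -/

theorem fewAdjPairs_of_freeOf {V : Type} {Γ : SignedGraph V} {t m : ℕ}
    (hfree : Γ.FreeOf (tK4Minus t)) (hm : 2 * (t - 1) ≤ m) : Γ.FewAdjPairs m :=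
  fun _ _ W huv hu hv hneg => (card_adj_offDiag_le hfree huv W hu hv hneg).trans hm

/-- Switching makes an eigenvector nonnegative. -/
theorem exists_switch_nearComplete {V : Type*} [Fintype V] [DecidableEq V] {Γ : SignedGraph V}
    {x : V → ℝ} (hx : x ⬝ᵥ x = 1) {lam : ℝ} (s : ℝ) (hs : s = 1 ∨ s = -1)
    (heig : Γ.adjMatrix *ᵥ x = (s * lam) • x) (hlt : (Fintype.card V : ℝ) - 2 < lam)
    (hlarge : 100000 ≤ Fintype.card V) :
    ∃ (U : Set V) (y : V → ℝ), NearComplete (s • (Γ.switch U).adjMatrix) y lam := by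
  -- Switching at the negative coordinates replaces x by |x|; the factor √n then makes the squared
  -- norm the order.
  let U : Set V := {a | x a < 0}
  let ε : V → ℝ := fun a => ((potential U a : ℤ) : ℝ)
  have hε : ∀ a, ε a * ε a = 1 := potential_mul_self U
  have hpos : ∀ a, 0 ≤ ε a * x a := by
    intro a
    by_cases ha : x a < 0
    · have : ε a = -1 := by simp [ε, potential, U, ha]
      rw [this]; linarith
    · have : ε a = 1 := by simp [ε, potential, U, ha]
      rw [this]; linarith
  have hss : s * s = 1 := by rcases hs with rfl | rfl <;> norm_num
  have hbd : ∀ i j, s * (Γ.switch U).adjMatrix i j ≤ 1 ∧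
      -1 ≤ s * (Γ.switch U).adjMatrix i j := by
    intro i j
    rcases (Γ.switch U).adjMatrix_trichotomy i j with ⟨-, e⟩ | ⟨-, -, e⟩ | ⟨-, -, e⟩ <;>
      rcases hs with rfl | rfl <;> rw [e] <;> norm_num
  have hsq : √(Fintype.card V : ℝ) ^ 2 = Fintype.card V := Real.sq_sqrt (Nat.cast_nonneg _)
  refine ⟨U, fun a => √(Fintype.card V : ℝ) * (ε a * x a), ?_, ?_, ?_, ?_, ?_, ?_, ?_, hlt, hlarge⟩
  · intro i j
    rw [Matrix.smul_apply, Matrix.smul_apply, adjMatrix_comm]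
  · intro i
    rw [Matrix.smul_apply, adjMatrix_self, smul_zero]
  · exact fun i j => (hbd i j).1
  · exact fun i j => (hbd i j).2
  · exact fun i => mul_nonneg (Real.sqrt_nonneg _) (hpos i)
  · have : ∀ i, (√(Fintype.card V : ℝ) * (ε i * x i)) ^ 2 = Fintype.card V * (x i * x i) := by
      intro i
      calc _ = √(Fintype.card V : ℝ) ^ 2 * (ε i * ε i) * (x i * x i) := by ring
        _ = _ := by rw [hsq, hε, mul_one]
    simp only [this, ← Finset.mul_sum]
    rw [show ∑ i, x i * x i = 1 from hx, mul_one]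
  · intro i
    have h1 := congrFun heig i
    rw [mulVec, dotProduct, Pi.smul_apply, smul_eq_mul] at h1
    have : ∀ j, (s • (Γ.switch U).adjMatrix) i j * (√(Fintype.card V : ℝ) * (ε j * x j)) =
        s * √(Fintype.card V : ℝ) * ε i * (Γ.adjMatrix i j * x j) := by
      intro j
      rw [Matrix.smul_apply, smul_eq_mul, adjMatrix_switch]
      calc _ = s * √(Fintype.card V : ℝ) * ε i * (Γ.adjMatrix i j * x j) * (ε j * ε j) := by
            simp only [ε]; ring
        _ = _ := by rw [hε, mul_one]
    simp only [this, ← Finset.mul_sum, h1]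
    calc _ = (s * s) * (lam * (√(Fintype.card V : ℝ) * (ε i * x i))) := by ring
      _ = _ := by rw [hss, one_mul]

/-- An unbalanced free signed graph of spectral radius at least that of `Γ_{r,n}` is switching
equivalent to `Γ_{r,n}`. -/
theorem switchingEquivalent_gam_of_le {n t r : ℕ} (hn : 100000 ≤ n) (hr : 2 ≤ r)
    (hrt : 2 * (t - 1) ≤ r * (r - 1)) (hrn : 2 * r + 4 ≤ n) {Γ : SignedGraph (Fin n)}
    (hunb : Γ.Unbalanced) (hfree : Γ.FreeOf (tK4Minus t))
    (hle : (Gam r n).spectralRadius ≤ Γ.spectralRadius) : Γ.SwitchingEquivalent (Gam r n) := by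
  have : Nonempty (Fin n) := ⟨⟨0, by omega⟩⟩
  have hfew := fewAdjPairs_of_freeOf hfree hrt
  have hlt : (Fintype.card (Fin n) : ℝ) - 2 < Γ.spectralRadius := by
    rw [Fintype.card_fin]
    exact (spectralRadius_gam_gt hr (by omega)).trans_le hle
  have hlarge : 100000 ≤ Fintype.card (Fin n) := by rwa [Fintype.card_fin]
  obtain ⟨x, hx, hx' | hx'⟩ := Γ.exists_eigenvector
  · obtain ⟨U, y, hnc⟩ := exists_switch_nearComplete hx (lam := Γ.spectralRadius) 1 (.inl rfl)
      (by rw [hx', one_mul]) hlt hlarge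
    rw [one_smul] at hnc
    obtain ⟨a, b, hab, hs⟩ := exists_neg_edge_switch hunb U
    have hab' : (Γ.switch U).adjMatrix a b = -1 := by
      rw [adjMatrix_eq_of_adj (Γ := Γ.switch U) hab, hs]
      norm_num
    exact ⟨Γ.switch U, reachable_switch Γ U,
      isomorphic_gam_of_le hnc hr (by omega) (hfew.switch U) hab' hle⟩
  · obtain ⟨U, y, hnc⟩ := exists_switch_nearComplete hx (lam := Γ.spectralRadius) (-1) (.inr rfl)
      (by rw [hx', neg_one_mul]) hlt hlarge
    rw [neg_one_smul] at hnc
    exact absurd hnc (not_nearComplete_neg (r := r) (by rw [Fintype.card_fin]; omega)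
      (hfew.switch U))

end SignedGraph

theorem mainTheorem2 :
    ∃ N : ℕ, ∀ n : ℕ, N ≤ n → ∀ t r : ℕ, 2 ≤ t →
      (r : ℝ) = (1 + Real.sqrt (8 * (t : ℝ) - 7)) / 2 →
      (r : ℤ) ≤ ⌊(n : ℝ) / 2⌋ - 2 →
      ∀ Γ : SignedGraph (Fin n), Γ.Unbalanced → Γ.FreeOf (SignedGraph.tK4Minus t) →
        Γ.spectralRadius ≤ (SignedGraph.Gam r n).spectralRadius ∧
        (Γ.spectralRadius = (SignedGraph.Gam r n).spectralRadius ↔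
          Γ.SwitchingEquivalent (SignedGraph.Gam r n)) := by
  refine ⟨100000, fun n hn t r ht hrt hrn Γ hunb hfree => ?_⟩
  have : Nonempty (Fin n) := ⟨⟨0, by omega⟩⟩
  have htR : (2 : ℝ) ≤ t := by exact_mod_cast ht
  have hsqrt : Real.sqrt (8 * (t : ℝ) - 7) = 2 * r - 1 := by linarith
  have hsq : (8 * (t : ℝ) - 7) = (2 * r - 1) ^ 2 := by
    rw [← hsqrt, Real.sq_sqrt (by linarith)]
  have hr1 : (1 : ℝ) < r := by
    have h0 := Real.sqrt_nonneg (8 * (t : ℝ) - 7)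
    rw [hsqrt] at h0
    nlinarith
  have hr : 2 ≤ r := by exact_mod_cast hr1
  -- (2r-1)² = 8t-7 amounts to r(r-1) = 2(t-1).
  have hrt' : 2 * (t - 1) ≤ r * (r - 1) := by
    have h1 : (2 : ℝ) * ((t - 1 : ℕ) : ℝ) ≤ r * ((r - 1 : ℕ) : ℝ) := by
      rw [Nat.cast_sub (by omega), Nat.cast_sub (by omega)]
      push_cast
      nlinarith
    exact_mod_cast h1
  have hrn' : 2 * r + 4 ≤ n := by
    have h1 : ((r + 2 : ℤ) : ℝ) ≤ (n : ℝ) / 2 := Int.le_floor.1 (by omega)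
    push_cast at h1
    have h2 : (2 * r + 4 : ℝ) ≤ n := by linarith
    exact_mod_cast h2
  -- This also gives the inequality: a strictly larger radius would imply equivalence, hence equal
  -- radii.
  have key := SignedGraph.switchingEquivalent_gam_of_le hn hr hrt' hrn' hunb hfree
  refine ⟨?_, fun h => key h.ge, SignedGraph.spectralRadius_eq_of_switchingEquivalent⟩
  by_contra! hcon
  exact hcon.ne' (SignedGraph.spectralRadius_eq_of_switchingEquivalent (key hcon.le))
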